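/- Let $K$ be a field, $n\ge 0$, $S=K[x_1,\ldots,x_n]$ with its standard $\mathbb Z^n$-grading, $\sigma\subset[n]=\{1,\ldots,n\}$, $\sigma^{c}=[n]\setminus\sigma$, and $K[\sigma]=K[x_i\mid i\in\sigma]\subset S$ with its standard $\mathbb Z^{\sigma}$-grading. A finitely generated $\mathbb N^n$-graded $S$-module $M=\bigoplus_{\alpha\in\mathbb N^n}M_\alpha$ is called squarefree if the multiplication map $M_\alpha\to M_{\alpha+\mathbf e_i}$, $y\mapsto x_iy$, is bijective for all $\alpha\in\mathbb N^n$ and all $i$ with $\alpha_i\neq 0$. For a $\mathbb Z^n$-graded $S$-module $M$ and $\beta\in\mathbb Z^n$, let $M(\beta)$ be the shifted module with $M(\beta)_\alpha=M_{\alpha+\beta}$, and let $$M|_\sigma=\bigoplus_{\alpha\in\mathbb N^n,\ \operatorname{supp}(\alpha)\subset\sigma}M_\alpha,$$ regarded as an $\mathbb N^{\sigma}$-graded $K[\sigma]$-module. Put $\mathfrak l_\sigma(M)=M(\sigma^{c})|_\sigma$, where $\sigma^{c}$ is identified with its $0$-$1$ vector. Let $\omega_S=S(-\mathbf 1)$ and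 $\omega_{K[\sigma]}=K[\sigma](-\mathbf 1_\sigma)$ be the graded canonical modules. Let $M$ be a squarefree $S$-module and $i\ge 0$. Then $\operatorname{Ext}^i_S(M,\omega_S)$, with its natural $\mathbb Z^n$-grading (induced by graded projective resolutions of $M$), is again a squarefree $S$-module, and there is an isomorphism of graded $K[\sigma]$-modules $$\mathfrak l_\sigma\bigl(\operatorname{Ext}^i_S(M,\omega_S)\bigr)\;\cong\;\operatorname{Ext}^i_{K[\sigma]}\bigl(\mathfrak l_\sigma(M),\omega_{K[\sigma]}\bigr).$$ -/

import Mathlib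

universe u

open CategoryTheory

noncomputable section

namespace Multigraded

section General

variable {K : Type u} [Field K] {ι : Type} [Fintype ι] [DecidableEq ι]

/-- The standard `ℤ^ι`-grading of the polynomial ring `K[x_i | i ∈ ι]`, in which the variable
`x_i` has degree `e_i`. -/
def polyGrading (K : Type u) [Field K] (ι : Type) [DecidableEq ι] (α : ι → ℤ) :
    Submodule K (MvPolynomial ι K) :=
  MvPolynomial.weightedHomogeneousSubmodule K (fun i : ι => (Pi.single i 1 : ι → ℤ)) α

/-- The family `ℳ` of additive subgroups of the `K[x_i | i ∈ ι]`-module `M` makes it a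
`ℤ^ι`-graded module: `M` is the internal direct sum of the `ℳ α`, and `S_α M_β ⊆ M_{α+β}`. -/
structure IsGraded {M : ModuleCat.{u} (MvPolynomial ι K)}
    (ℳ : (ι → ℤ) → AddSubgroup M) : Prop where
  isInternal : DirectSum.IsInternal ℳ
  smul_mem : ∀ (α β : ι → ℤ), ∀ p ∈ polyGrading K ι α, ∀ m ∈ ℳ β, p • m ∈ ℳ (α + β)

/-- Squarefree modules: finitely generated `ℕ^ι`-graded modules such that multiplication by `x_i`
is a bijection `M_α → M_{α + e_i}` for all `α ∈ ℕ^ι` and all `i` in the support of `α`. -/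
structure IsSquarefree {M : ModuleCat.{u} (MvPolynomial ι K)}
    (ℳ : (ι → ℤ) → AddSubgroup M) : Prop where
  isGraded : IsGraded ℳ
  finite : Module.Finite (MvPolynomial ι K) M
  eq_bot : ∀ α : ι → ℤ, ¬ 0 ≤ α → ℳ α = ⊥
  bijOn : ∀ α : ι → ℤ, 0 ≤ α → ∀ i : ι, α i ≠ 0 →
    Set.BijOn (fun m : M => (MvPolynomial.X i : MvPolynomial ι K) • m)
      (ℳ α) (ℳ (α + Pi.single i 1))

/-- The shift `M(β)`, with `M(β)_α = M_{α+β}`. -/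
def shift {M : ModuleCat.{u} (MvPolynomial ι K)} (ℳ : (ι → ℤ) → AddSubgroup M) (β : ι → ℤ) :
    (ι → ℤ) → AddSubgroup M :=
  fun α => ℳ (α + β)

/-- The polynomial ring as a module over itself; this is the module underlying the canonical
module `ω = S(-𝟏)`. -/
abbrev polyModule (K : Type u) [Field K] (ι : Type) : ModuleCat.{u} (MvPolynomial ι K) :=
  ModuleCat.of (MvPolynomial ι K) (MvPolynomial ι K)

/-- The grading of the canonical module `ω = S(-𝟏)`. -/
def omegaGrading (K : Type u) [Field K] (ι : Type) [DecidableEq ι] :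
    (ι → ℤ) → AddSubgroup (polyModule K ι) :=
  shift (M := polyModule K ι) (fun α => (polyGrading K ι α).toAddSubgroup) (-1)

/-- The map `f` is homogeneous of degree `α`: it maps `M_β` into `N_{α+β}` for all `β`. -/
def IsHomogeneousMap {M N : ModuleCat.{u} (MvPolynomial ι K)} (ℳ : (ι → ℤ) → AddSubgroup M)
    (𝒩 : (ι → ℤ) → AddSubgroup N) (α : ι → ℤ) (f : M ⟶ N) : Prop :=
  ∀ (β : ι → ℤ), ∀ m ∈ ℳ β, f.hom m ∈ 𝒩 (α + β)

/-- The gradings `𝒬 k` make the projective resolution `P` of `M` a graded resolution: its terms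
are graded modules, and the differentials and the augmentation `P_0 → M` preserve degrees. -/
structure IsGradedResolution {M : ModuleCat.{u} (MvPolynomial ι K)}
    (ℳ : (ι → ℤ) → AddSubgroup M) (P : ProjectiveResolution M)
    (𝒬 : ∀ k : ℕ, (ι → ℤ) → AddSubgroup (P.complex.X k)) : Prop where
  isGraded : ∀ k, IsGraded (𝒬 k)
  d_mem : ∀ k, IsHomogeneousMap (𝒬 (k + 1)) (𝒬 k) 0 (P.complex.d (k + 1) k)
  π_mem : IsHomogeneousMap (N := M) (𝒬 0) ℳ 0 (P.π.f 0)

/-- The module `Ext^i_S(M, N)` over `S = K[x_i | i ∈ ι]`. -/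
abbrev extModule (M N : ModuleCat.{u} (MvPolynomial ι K)) (i : ℕ) :
    ModuleCat.{u} (MvPolynomial ι K) :=
  ModuleCat.of (MvPolynomial ι K) (Abelian.Ext M N i)

/-- The natural `ℤ^ι`-grading of `Ext^i_S(M, N)` for graded modules `M` (finitely generated) and
`N`: the component of degree `α` consists of the classes that are represented by cocycles
`f : P_i → N` that are homogeneous of degree `α`, for graded projective resolutions `P` of `M`.
(Any two graded resolutions give the same classes.) -/
def extGrading {M N : ModuleCat.{u} (MvPolynomial ι K)} (ℳ : (ι → ℤ) → AddSubgroup M)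
    (𝒩 : (ι → ℤ) → AddSubgroup N) (i : ℕ) : (ι → ℤ) → AddSubgroup (extModule M N i) :=
  fun α => AddSubgroup.closure
    {e : Abelian.Ext M N i | ∃ (P : ProjectiveResolution M)
      (𝒬 : ∀ k : ℕ, (ι → ℤ) → AddSubgroup (P.complex.X k)),
      IsGradedResolution ℳ P 𝒬 ∧
      ∃ (f : P.complex.X i ⟶ N) (hf : P.complex.d (i + 1) i ≫ f = 0),
        IsHomogeneousMap (𝒬 i) 𝒩 α f ∧ P.extMk f (i + 1) rfl hf = e}

/-- `M` and `N` are isomorphic as graded modules. -/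
def GradedIso {M N : ModuleCat.{u} (MvPolynomial ι K)} (ℳ : (ι → ℤ) → AddSubgroup M)
    (𝒩 : (ι → ℤ) → AddSubgroup N) : Prop :=
  ∃ e : M ≃ₗ[MvPolynomial ι K] N, ∀ (α : ι → ℤ) (m : M), m ∈ ℳ α ↔ e m ∈ 𝒩 α

end General

section Restriction

variable {K : Type u} [Field K] {ι : Type} [Fintype ι] [DecidableEq ι]

/-- The inclusion `K[σ] = K[x_i | i ∈ σ] → K[x_i | i ∈ ι]`. -/
def inclusion (K : Type u) [Field K] (σ : Finset ι) : MvPolynomial σ K →+* MvPolynomial ι K :=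
  (MvPolynomial.rename (R := K) (Subtype.val : σ → ι)).toRingHom

/-- Extension by zero `ℤ^σ → ℤ^ι`. -/
def extendZero (σ : Finset ι) (α : σ → ℤ) : ι → ℤ :=
  fun i => if h : i ∈ σ then α ⟨i, h⟩ else 0

/-- The 0-1 vector of `σ`. -/
def indicator (σ : Finset ι) : ι → ℤ := fun i => if i ∈ σ then 1 else 0

/-- The `K[σ]`-submodule `M|_σ = ⨁ M_α` of `M`, the sum being over all `α ∈ ℕ^ι` with support
in `σ`. (If `M` is graded, then this sum of subgroups is closed under the action of `K[σ]`.) -/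
def restrictSubmodule {M : ModuleCat.{u} (MvPolynomial ι K)} (ℳ : (ι → ℤ) → AddSubgroup M)
    (σ : Finset ι) :
    Submodule (MvPolynomial σ K) ((ModuleCat.restrictScalars (inclusion K σ)).obj M) :=
  Submodule.span (MvPolynomial σ K) {m : M | ∃ α : σ → ℤ, 0 ≤ α ∧ m ∈ ℳ (extendZero σ α)}

/-- `M|_σ` as a `K[σ]`-module. -/
abbrev restrictModule {M : ModuleCat.{u} (MvPolynomial ι K)} (ℳ : (ι → ℤ) → AddSubgroup M)
    (σ : Finset ι) : ModuleCat.{u} (MvPolynomial σ K) :=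
  ModuleCat.of (MvPolynomial σ K) (restrictSubmodule ℳ σ)

/-- The `ℕ^σ`-grading of `M|_σ`. -/
def restrictGrading {M : ModuleCat.{u} (MvPolynomial ι K)} (ℳ : (ι → ℤ) → AddSubgroup M)
    (σ : Finset ι) : (σ → ℤ) → AddSubgroup (restrictModule ℳ σ) :=
  open scoped Classical in fun α =>
    if 0 ≤ α then
      AddSubgroup.comap (restrictSubmodule ℳ σ).subtype.toAddMonoidHom (ℳ (extendZero σ α))
    else ⊥

/-- The `K[σ]`-module `𝔩_σ(M) = M(σᶜ)|_σ`. -/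
abbrev lModule {M : ModuleCat.{u} (MvPolynomial ι K)} (ℳ : (ι → ℤ) → AddSubgroup M)
    (σ : Finset ι) : ModuleCat.{u} (MvPolynomial σ K) :=
  restrictModule (shift ℳ (indicator σᶜ)) σ

/-- The grading of `𝔩_σ(M) = M(σᶜ)|_σ`. -/
abbrev lGrading {M : ModuleCat.{u} (MvPolynomial ι K)} (ℳ : (ι → ℤ) → AddSubgroup M)
    (σ : Finset ι) : (σ → ℤ) → AddSubgroup (lModule ℳ σ) :=
  restrictGrading (shift ℳ (indicator σᶜ)) σ

end Restriction

end Multigraded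

end

set_option linter.unusedSectionVars false
set_option linter.unusedVariables false

/-! `Ext` is the cohomology of `Hom_S(P, ω_S)` for a suitable free resolution `P` of `M`, and both
claims come from keeping every degree of a generator a 0-1 vector.

A squarefree module is generated in 0-1 degrees (`IsSquarefree.mem_span`). A finite free module on
such generators is squarefree (`IsGradedFree.isSquarefree`), and so are kernels of degree-preserving
maps between squarefree modules. Iterating syzygies therefore gives a resolution by finite free
modules with generators in 0-1 degrees. Dualizing into `ω = S(-𝟏)` turns a generator of degree `d`
into one of degree `𝟏 - d`, again a 0-1 vector, so the dual complex consists of squarefree modules.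
Its cohomology, a kernel modulo an image, is squarefree (`IsGradedCohomology.isSquarefree`). Since
the grading of `Ext` refers to all graded projective resolutions, `mem_extGrading_iff` first reduces
it to the chosen one.

The functor `𝔩_σ` only selects graded pieces, so it is exact. It sends the free module on `b_j` of
degree `d_j` to the free `K[σ]`-module on the elements `x^(σᶜ - d_j) b_j` (`exists_lBasis`), so
`𝔩_σ(P)` resolves `𝔩_σ(M)`. Matching generators identifies `𝔩_σ(Hom_S(P_k, ω_S))` with
`Hom_{K[σ]}(𝔩_σ(P_k), ω_{K[σ]})`. The matched generators pair to `x^(σᶜ - d) x^(σᶜ - (𝟏 - d)) =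
x^(σᶜ)`, whatever `d` is. Hence the identification `Φ` satisfies the basis-free formula `Φ(f)(p)
x^(σᶜ) = f(p)` (`inclusion_lDualEquiv`) and commutes with the differentials. Passing to cohomology
(`IsGradedCohomology.gradedIso`) gives the isomorphism. -/

noncomputable section

namespace Multigraded

/-! ### Homogeneous components in graded abelian groups -/

section Components

variable {D : Type*} [DecidableEq D] {M N : Type*} [AddCommGroup M] [AddCommGroup N]
  {ℳ : D → AddSubgroup M}

/-- The homogeneous component of degree `α` of an element of a graded group. -/
def component (h : DirectSum.IsInternal ℳ) (α : D) : M →+ M :=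
  (ℳ α).subtype.comp ((DFinsupp.evalAddMonoidHom α).comp
    (AddEquiv.ofBijective (DirectSum.coeAddMonoidHom ℳ) h).symm.toAddMonoidHom)

theorem component_mem (h : DirectSum.IsInternal ℳ) (α : D) (m : M) : component h α m ∈ ℳ α :=
  SetLike.coe_mem _

theorem component_eq_ite (h : DirectSum.IsInternal ℳ) {α β : D} {m : M} (hm : m ∈ ℳ β) :
    component h α m = if α = β then m else 0 := by
  have key : (AddEquiv.ofBijective (DirectSum.coeAddMonoidHom ℳ) h).symm m =
      DirectSum.of (fun α => ℳ α) β ⟨m, hm⟩ := by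
    rw [AddEquiv.symm_apply_eq]
    exact (DirectSum.coeAddMonoidHom_of ℳ β ⟨m, hm⟩).symm
  have : component h α m = ((DirectSum.of (fun α => ℳ α) β ⟨m, hm⟩) α : ℳ α) := by
    rw [← key]; rfl
  rw [this]
  split_ifs with hαβ
  · subst hαβ
    rw [DirectSum.of_eq_same]
  · rw [DirectSum.of_eq_of_ne _ _ _ hαβ]
    rfl

theorem component_of_mem (h : DirectSum.IsInternal ℳ) {α : D} {m : M} (hm : m ∈ ℳ α) :
    component h α m = m := by
  rw [component_eq_ite h hm, if_pos rfl]

theorem component_of_mem_ne (h : DirectSum.IsInternal ℳ) {α β : D} {m : M} (hm : m ∈ ℳ β)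
    (hαβ : α ≠ β) : component h α m = 0 := by
  rw [component_eq_ite h hm, if_neg hαβ]

theorem exists_eq_sum_component (h : DirectSum.IsInternal ℳ) (m : M) :
    ∃ s : Finset D, m = ∑ α ∈ s, component h α m := by
  classical
  obtain ⟨x, rfl⟩ := h.surjective m
  have hx : (AddEquiv.ofBijective (DirectSum.coeAddMonoidHom ℳ) h).symm
      (DirectSum.coeAddMonoidHom ℳ x) = x := by
    rw [AddEquiv.symm_apply_eq]
    rfl
  refine ⟨DFinsupp.support x, ?_⟩
  have : ∀ α, component h α (DirectSum.coeAddMonoidHom ℳ x) = (x α : M) := fun α => by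
    conv_rhs => rw [← hx]
    rfl
  simp only [this]
  exact DirectSum.coeAddMonoidHom_eq_dfinsuppSum ℳ x

theorem component_induction (h : DirectSum.IsInternal ℳ) {C : M → Prop} (m : M)
    (hC : ∀ α, C (component h α m)) (h0 : C 0) (hadd : ∀ x y, C x → C y → C (x + y)) : C m := by
  obtain ⟨s, hs⟩ := exists_eq_sum_component h m
  rw [hs]
  exact Finset.sum_induction _ C hadd h0 fun α _ => hC α

theorem homogeneous_induction (h : DirectSum.IsInternal ℳ) {C : M → Prop} (m : M)
    (hC : ∀ α, ∀ m ∈ ℳ α, C m) (h0 : C 0) (hadd : ∀ x y, C x → C y → C (x + y)) : C m :=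
  component_induction h m (fun α => hC α _ (component_mem h α m)) h0 hadd

/-- A family of subgroups that generates is an internal direct sum as soon as its members can be
separated by additive maps. -/
theorem isInternal_of_separating {ℳ : D → AddSubgroup M} (t : D → M →+ N)
    (hne : ∀ α β, α ≠ β → ∀ m ∈ ℳ β, t α m = 0) (hinj : ∀ α, ∀ m ∈ ℳ α, t α m = 0 → m = 0)
    (hsup : ∀ m, m ∈ ⨆ α, ℳ α) : DirectSum.IsInternal ℳ := by
  classical
  constructor
  · rw [injective_iff_map_eq_zero]
    intro x hx
    refine DFinsupp.ext fun α => ?_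
    have h1 : t α (DirectSum.coeAddMonoidHom ℳ x) = t α (x α : M) := by
      rw [DirectSum.coeAddMonoidHom_eq_dfinsuppSum, DFinsupp.sum, map_sum]
      refine Finset.sum_eq_single α (fun β _ hβ => hne α β hβ.symm _ (x β).2) fun hα => ?_
      rw [DFinsupp.notMem_support_iff.1 hα]
      exact map_zero _
    rw [hx, map_zero] at h1
    exact Subtype.ext (hinj α _ (x α).2 h1.symm)
  · intro m
    have : (⨆ α, ℳ α) ≤ (DirectSum.coeAddMonoidHom ℳ).range := by
      refine iSup_le fun α m hm => ⟨DirectSum.of (fun α => ℳ α) α ⟨m, hm⟩, ?_⟩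
      exact DirectSum.coeAddMonoidHom_of ℳ α ⟨m, hm⟩
    exact this (hsup m)

/-- Both sides are additive in `m`, so homogeneous `m` suffice; injectivity of `s` keeps different
degrees apart. The relabelling `s` allows translations of the degree as well as the identity. -/
theorem component_map {E : Type*} [DecidableEq E] {𝒩 : E → AddSubgroup N}
    (h : DirectSum.IsInternal ℳ) (h' : DirectSum.IsInternal 𝒩) (f : M →+ N) (s : D → E)
    (hs : Function.Injective s) (hf : ∀ α, ∀ m ∈ ℳ α, f m ∈ 𝒩 (s α)) (α : D) (m : M) :
    component h' (s α) (f m) = f (component h α m) := by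
  refine homogeneous_induction h (C := fun m => component h' (s α) (f m) = f (component h α m)) m
    (fun β m hm => ?_) (by simp) fun x y hx hy => by simp only [map_add, hx, hy]
  rw [component_eq_ite h hm, component_eq_ite h' (hf β m hm)]
  by_cases hαβ : α = β
  · simp [hαβ]
  · simp [hαβ, hs.ne hαβ]

/-- A family of subgroups mapped injectively into a grading is an internal direct sum as soon as
it generates. -/
theorem isInternal_of_injective {E : Type*} [DecidableEq E] {𝒩 : E → AddSubgroup N}
    (h' : DirectSum.IsInternal 𝒩) (f : M →+ N) (hfi : Function.Injective f) (s : D → E)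
    (hs : Function.Injective s) (hf : ∀ α, ∀ m ∈ ℳ α, f m ∈ 𝒩 (s α))
    (hsup : ∀ m, m ∈ ⨆ α, ℳ α) : DirectSum.IsInternal ℳ := by
  refine isInternal_of_separating (fun α => (component h' (s α)).comp f) ?_ ?_ hsup
  · intro α β hαβ m hm
    exact component_of_mem_ne h' (hf β m hm) (hs.ne hαβ)
  · intro α m hm h0
    rw [AddMonoidHom.comp_apply, component_of_mem h' (hf α m hm)] at h0
    exact hfi (h0.trans (map_zero f).symm)

end Components

/-! ### The fine grading of the polynomial ring -/

section Polynomial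

variable {K : Type u} [Field K] {ι : Type}

/-- The degree in `ℤ^ι` of an exponent vector. -/
def natDeg (d : ι →₀ ℕ) : ι → ℤ := fun i => (d i : ℤ)

theorem natDeg_injective : Function.Injective (natDeg : (ι →₀ ℕ) → ι → ℤ) := fun d e h =>
  Finsupp.ext fun i => Nat.cast_injective (R := ℤ) (congrFun h i)

theorem natDeg_add (d e : ι →₀ ℕ) : natDeg (d + e) = natDeg d + natDeg e := by
  funext i
  simp [natDeg]

theorem natDeg_nonneg (d : ι →₀ ℕ) : 0 ≤ natDeg d := fun i => by simp [natDeg]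

theorem exists_natDeg_eq [Finite ι] {α : ι → ℤ} (h : 0 ≤ α) : ∃ d : ι →₀ ℕ, natDeg d = α :=
  ⟨Finsupp.equivFunOnFinite.symm fun i => (α i).toNat, funext fun i => by
    simpa [natDeg] using h i⟩

variable [DecidableEq ι]

theorem natDeg_single (i : ι) : natDeg (Finsupp.single i 1) = Pi.single i 1 := by
  funext j
  by_cases h : i = j
  · subst h; simp [natDeg]
  · simp [natDeg, Ne.symm h]

theorem weight_single_eq_natDeg (d : ι →₀ ℕ) :
    Finsupp.weight (fun i : ι => (Pi.single i 1 : ι → ℤ)) d = natDeg d := by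
  funext i
  rw [Finsupp.weight_apply, Finsupp.sum, Finset.sum_apply]
  simp only [Pi.smul_apply, Pi.single_apply, nsmul_eq_mul, mul_ite, mul_one, mul_zero, natDeg]
  rw [Finset.sum_ite_eq, ite_eq_left_iff]
  intro h
  rw [Finsupp.notMem_support_iff.1 h, Nat.cast_zero]

theorem mem_polyGrading_iff {α : ι → ℤ} {p : MvPolynomial ι K} :
    p ∈ polyGrading K ι α ↔ ∀ d, p.coeff d ≠ 0 → natDeg d = α := by
  rw [polyGrading, MvPolynomial.mem_weightedHomogeneousSubmodule]
  simp only [MvPolynomial.IsWeightedHomogeneous, weight_single_eq_natDeg]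

theorem monomial_mem_polyGrading (d : ι →₀ ℕ) (c : K) :
    MvPolynomial.monomial d c ∈ polyGrading K ι (natDeg d) := by
  classical
  rw [mem_polyGrading_iff]
  intro e he
  rw [MvPolynomial.coeff_monomial] at he
  split_ifs at he with h
  · rw [h]
  · exact absurd rfl he

theorem X_mem_polyGrading (i : ι) :
    (MvPolynomial.X i : MvPolynomial ι K) ∈ polyGrading K ι (Pi.single i 1) := by
  rw [← natDeg_single]
  exact monomial_mem_polyGrading _ 1

theorem C_mem_polyGrading (c : K) : MvPolynomial.C c ∈ polyGrading K ι 0 := by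
  have := monomial_mem_polyGrading (ι := ι) 0 c
  rwa [show natDeg (0 : ι →₀ ℕ) = 0 from funext fun i => by simp [natDeg]] at this

theorem mul_mem_polyGrading {α β : ι → ℤ} {p q : MvPolynomial ι K} (hp : p ∈ polyGrading K ι α)
    (hq : q ∈ polyGrading K ι β) : p * q ∈ polyGrading K ι (α + β) :=
  MvPolynomial.IsWeightedHomogeneous.mul hp hq

theorem eq_monomial_of_mem {d : ι →₀ ℕ} {p : MvPolynomial ι K}
    (hp : p ∈ polyGrading K ι (natDeg d)) : p = MvPolynomial.monomial d (p.coeff d) := by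
  classical
  rw [mem_polyGrading_iff] at hp
  ext e
  rw [MvPolynomial.coeff_monomial]
  split_ifs with h
  · rw [h]
  · by_contra h'
    exact h (natDeg_injective (hp e h')).symm

theorem eq_zero_of_mem_of_not_nonneg {α : ι → ℤ} {p : MvPolynomial ι K}
    (hp : p ∈ polyGrading K ι α) (hα : ¬ 0 ≤ α) : p = 0 := by
  rw [mem_polyGrading_iff] at hp
  ext d
  by_contra h
  exact hα (hp d h ▸ natDeg_nonneg d)

theorem polynomial_induction {C : MvPolynomial ι K → Prop} (p : MvPolynomial ι K)
    (hC : ∀ α, ∀ p ∈ polyGrading K ι α, C p) (hadd : ∀ p q, C p → C q → C (p + q)) : C p :=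
  MvPolynomial.monomial_add_induction_on p
    (fun c => hC 0 _ (C_mem_polyGrading c))
    (fun d c p _ _ hp => hadd _ _ (hC _ _ (monomial_mem_polyGrading d c)) hp)

theorem isInternal_polyGrading [Fintype ι] :
    DirectSum.IsInternal fun α => (polyGrading K ι α).toAddSubgroup := by
  refine isInternal_of_separating (fun α =>
    (MvPolynomial.weightedHomogeneousComponent (R := K)
      (fun i : ι => (Pi.single i 1 : ι → ℤ)) α).toAddMonoidHom) ?_ ?_ ?_
  · intro α β hαβ p hp
    exact (MvPolynomial.weightedHomogeneousComponent_of_mem hp).trans (if_neg hαβ)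
  · intro α p hp h0
    have := MvPolynomial.weightedHomogeneousComponent_of_mem (m := α) hp
    rw [if_pos rfl] at this
    exact this.symm.trans h0
  · intro p
    exact polynomial_induction p (fun α p hp => AddSubgroup.mem_iSup_of_mem α hp)
      fun p q hp hq => add_mem hp hq

/-- If `α` is nonnegative, the piece of degree `α + e_i` is spanned by one monomial, which is
divisible by `x_i`. Otherwise a coordinate other than `i` is negative, and `p = 0`. -/
theorem exists_mul_X_of_mem [Finite ι] {α : ι → ℤ} {i : ι} (hi : 0 ≤ α i) {p : MvPolynomial ι K}
    (hp : p ∈ polyGrading K ι (α + Pi.single i 1)) :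
    ∃ q ∈ polyGrading K ι α, MvPolynomial.X i * q = p := by
  by_cases hα : 0 ≤ α
  · obtain ⟨d, rfl⟩ := exists_natDeg_eq hα
    refine ⟨MvPolynomial.monomial d (p.coeff (Finsupp.single i 1 + d)),
      monomial_mem_polyGrading _ _, ?_⟩
    rw [← natDeg_single, ← natDeg_add, add_comm] at hp
    conv_rhs => rw [eq_monomial_of_mem hp]
    rw [MvPolynomial.X, MvPolynomial.monomial_mul, one_mul]
  · refine ⟨0, zero_mem _, ?_⟩
    rw [mul_zero, eq_zero_of_mem_of_not_nonneg hp]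
    refine fun h => hα fun j => ?_
    by_cases hj : j = i
    · rw [hj]; exact hi
    · simpa [Pi.single_apply, hj] using h j

end Polynomial

/-! ### Degree-preserving maps and multiplication by variables -/

section Basic

variable {K : Type u} [Field K] {ι : Type} [Fintype ι] [DecidableEq ι]
  {M N : ModuleCat.{u} (MvPolynomial ι K)} {ℳ : (ι → ℤ) → AddSubgroup M}
  {𝒩 : (ι → ℤ) → AddSubgroup N}

theorem IsHomogeneousMap.component (hM : IsGraded ℳ) (hN : IsGraded 𝒩) {f : M ⟶ N}
    (hf : IsHomogeneousMap ℳ 𝒩 0 f) (α : ι → ℤ) (m : M) :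
    component hN.isInternal α (f.hom m) = f.hom (component hM.isInternal α m) := by
  refine component_map hM.isInternal hN.isInternal f.hom.toAddMonoidHom id
    Function.injective_id (fun β m hm => ?_) α m
  have := hf β m hm
  rwa [zero_add] at this

theorem IsHomogeneousMap.mem {f : M ⟶ N} (hf : IsHomogeneousMap ℳ 𝒩 0 f) {α : ι → ℤ} {m : M}
    (hm : m ∈ ℳ α) : f.hom m ∈ 𝒩 α := by
  have := hf α m hm
  rwa [zero_add] at this

theorem isHomogeneousMap_zero_of {f : M ⟶ N} (hf : ∀ α, ∀ m ∈ ℳ α, f.hom m ∈ 𝒩 α) :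
    IsHomogeneousMap ℳ 𝒩 0 f := fun α m hm => by
  rw [zero_add]
  exact hf α m hm

/-- A homogeneous element in the image of a degree-preserving map has a homogeneous preimage. -/
theorem IsHomogeneousMap.exists_preimage (hM : IsGraded ℳ) (hN : IsGraded 𝒩) {f : M ⟶ N}
    (hf : IsHomogeneousMap ℳ 𝒩 0 f) {α : ι → ℤ} {m : M} (hm : f.hom m ∈ 𝒩 α) :
    ∃ m' ∈ ℳ α, f.hom m' = f.hom m := by
  refine ⟨_, component_mem hM.isInternal α m, ?_⟩
  rw [← hf.component hM hN, component_of_mem hN.isInternal hm]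

theorem IsHomogeneousMap.comp {L : ModuleCat.{u} (MvPolynomial ι K)}
    {ℒ : (ι → ℤ) → AddSubgroup L} {f : L ⟶ M} {g : M ⟶ N} {α : ι → ℤ}
    (hf : IsHomogeneousMap ℒ ℳ 0 f) (hg : IsHomogeneousMap ℳ 𝒩 α g) :
    IsHomogeneousMap ℒ 𝒩 α (f ≫ g) := fun β m hm => hg β _ (hf.mem hm)

theorem IsGraded.X_smul_mem (hM : IsGraded ℳ) {α : ι → ℤ} {m : M} (hm : m ∈ ℳ α) (i : ι) :
    (MvPolynomial.X i : MvPolynomial ι K) • m ∈ ℳ (α + Pi.single i 1) := by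
  rw [add_comm]
  exact hM.smul_mem _ _ _ (X_mem_polyGrading i) _ hm

theorem IsSquarefree.eq_zero_of_X_smul (hM : IsSquarefree ℳ) {α : ι → ℤ} (hα : 0 ≤ α) {i : ι}
    (hi : α i ≠ 0) {m : M} (hm : m ∈ ℳ α)
    (h : (MvPolynomial.X i : MvPolynomial ι K) • m = 0) : m = 0 :=
  (hM.bijOn α hα i hi).injOn hm (zero_mem _) (h.trans (smul_zero _).symm)

theorem IsSquarefree.exists_X_smul (hM : IsSquarefree ℳ) {α : ι → ℤ} (hα : 0 ≤ α) {i : ι}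
    (hi : α i ≠ 0) {m : M} (hm : m ∈ ℳ (α + Pi.single i 1)) :
    ∃ m' ∈ ℳ α, (MvPolynomial.X i : MvPolynomial ι K) • m' = m :=
  (hM.bijOn α hα i hi).surjOn hm

theorem bijOn_X_smul (hM : IsGraded ℳ) {α : ι → ℤ} {i : ι}
    (hinj : ∀ m ∈ ℳ α, (MvPolynomial.X i : MvPolynomial ι K) • m = 0 → m = 0)
    (hsurj : ∀ m ∈ ℳ (α + Pi.single i 1),
      ∃ m' ∈ ℳ α, (MvPolynomial.X i : MvPolynomial ι K) • m' = m) :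
    Set.BijOn (fun m : M => (MvPolynomial.X i : MvPolynomial ι K) • m)
      (ℳ α) (ℳ (α + Pi.single i 1)) := by
  refine ⟨fun m hm => hM.X_smul_mem hm i, fun m hm m' hm' h => ?_, fun m hm => hsurj m hm⟩
  have h' : (MvPolynomial.X i : MvPolynomial ι K) • m = (MvPolynomial.X i : MvPolynomial ι K) • m' := h
  rw [← sub_eq_zero]
  refine hinj _ (sub_mem hm hm') ?_
  rw [smul_sub, h', sub_self]

end Basic

/-! ### Graded free modules and their duals -/

section Free

variable {K : Type u} [Field K] {ι : Type} [Fintype ι] [DecidableEq ι]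
  {P N : ModuleCat.{u} (MvPolynomial ι K)} {J : Type}

/-- The graded module `P` is free on the homogeneous basis `b`, with `b j` of degree `d j`. -/
def IsGradedFree (𝒬 : (ι → ℤ) → AddSubgroup P) (b : Module.Basis J (MvPolynomial ι K) P)
    (d : J → ι → ℤ) : Prop :=
  ∀ (α : ι → ℤ) (p : P), p ∈ 𝒬 α ↔ ∀ j, b.repr p j ∈ polyGrading K ι (α - d j)

variable {𝒬 : (ι → ℤ) → AddSubgroup P} {b : Module.Basis J (MvPolynomial ι K) P} {d : J → ι → ℤ}
  {𝒩 : (ι → ℤ) → AddSubgroup N}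

theorem IsGradedFree.smul_mem (h : IsGradedFree 𝒬 b d) {α β : ι → ℤ} {p : MvPolynomial ι K}
    (hp : p ∈ polyGrading K ι α) {m : P} (hm : m ∈ 𝒬 β) : p • m ∈ 𝒬 (α + β) := by
  rw [h]
  intro j
  rw [map_smul, Finsupp.smul_apply, smul_eq_mul, add_sub_assoc]
  exact mul_mem_polyGrading hp ((h _ _).1 hm j)

theorem IsGradedFree.basis_mem (h : IsGradedFree 𝒬 b d) (j : J) : b j ∈ 𝒬 (d j) := by
  classical
  rw [h]
  intro k
  rw [Module.Basis.repr_self, Finsupp.single_apply]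
  split_ifs with hjk
  · rw [hjk, sub_self, ← map_one MvPolynomial.C]
    exact C_mem_polyGrading 1
  · exact zero_mem _

theorem IsGradedFree.isGraded (h : IsGradedFree 𝒬 b d) : IsGraded 𝒬 := by
  refine ⟨?_, fun α β p hp m hm => h.smul_mem hp hm⟩
  refine isInternal_of_separating (N := J → MvPolynomial ι K) (fun α => AddMonoidHom.pi fun j =>
    (component (isInternal_polyGrading (K := K) (ι := ι)) (α - d j)).comp
      (b.coord j).toAddMonoidHom) ?_ ?_ ?_
  · intro α β hαβ p hp
    funext j
    exact component_of_mem_ne isInternal_polyGrading ((h β p).1 hp j)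
      fun h => hαβ (sub_left_injective h)
  · intro α p hp h0
    refine b.repr.map_eq_zero_iff.1 (Finsupp.ext fun j => ?_)
    exact (component_of_mem isInternal_polyGrading ((h α p).1 hp j)).symm.trans (congrFun h0 j)
  · intro p
    rw [← b.linearCombination_repr p, Finsupp.linearCombination_apply, Finsupp.sum]
    refine sum_mem fun j _ => ?_
    refine polynomial_induction (C := fun r => r • b j ∈ ⨆ α, 𝒬 α) _ (fun α r hr => ?_)
      fun p q hp hq => ?_
    · exact AddSubgroup.mem_iSup_of_mem _ (h.smul_mem hr (h.basis_mem j))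
    · rw [add_smul]
      exact add_mem hp hq

/-- Injectivity of `x_i` holds because the module is free over a domain; surjectivity is checked
coordinatewise with `exists_mul_X_of_mem`. -/
theorem IsGradedFree.isSquarefree [Finite J] (h : IsGradedFree 𝒬 b d) (h0 : ∀ j, 0 ≤ d j)
    (h1 : ∀ j, d j ≤ 1) : IsSquarefree 𝒬 where
  isGraded := h.isGraded
  finite := Module.Finite.of_basis b
  eq_bot α hα := by
    refine (AddSubgroup.eq_bot_iff_forall _).2 fun p hp => ?_
    refine b.repr.map_eq_zero_iff.1 (Finsupp.ext fun j => ?_)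
    refine eq_zero_of_mem_of_not_nonneg ((h α p).1 hp j) fun h' => hα ?_
    exact (h0 j).trans (sub_nonneg.1 h')
  bijOn α hα i hi := by
    classical
    have : Fintype J := Fintype.ofFinite J
    refine bijOn_X_smul h.isGraded (fun p _ hp => ?_) fun p hp => ?_
    · have : Module.Free (MvPolynomial ι K) P := Module.Free.of_basis b
      exact (smul_eq_zero.1 hp).resolve_left (MvPolynomial.X_ne_zero i)
    · have hp' := (h _ _).1 hp
      have : ∀ j, ∃ q ∈ polyGrading K ι (α - d j), MvPolynomial.X i * q = b.repr p j := fun j => by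
        refine exists_mul_X_of_mem ?_ ?_
        -- Here `α i ≥ 1` and `d j i ≤ 1`, so the coordinate degree `α - d j` is nonnegative at `i`.
        · have h1 := h1 j i
          have h2 := hα i
          simp only [Pi.sub_apply, Pi.one_apply, Pi.zero_apply] at h1 h2 ⊢
          lia
        · have := hp' j
          rwa [add_sub_right_comm] at this
      choose q hq hqp using this
      refine ⟨b.equivFun.symm q, (h _ _).2 fun j => ?_, ?_⟩
      · rw [← b.equivFun_apply, LinearEquiv.apply_symm_apply]
        exact hq j
      · refine b.equivFun.injective (funext fun j => ?_)
        rw [map_smul, LinearEquiv.apply_symm_apply, Pi.smul_apply, smul_eq_mul, hqp,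
          b.equivFun_apply]

theorem IsGradedFree.isHomogeneousMap_iff (h : IsGradedFree 𝒬 b d) (hN : IsGraded 𝒩)
    {α : ι → ℤ} {f : P ⟶ N} :
    IsHomogeneousMap 𝒬 𝒩 α f ↔ ∀ j, f.hom (b j) ∈ 𝒩 (α + d j) := by
  refine ⟨fun hf j => hf _ _ (h.basis_mem j), fun hf β p hp => ?_⟩
  rw [← b.linearCombination_repr p, Finsupp.linearCombination_apply, Finsupp.sum, map_sum]
  refine sum_mem fun j _ => ?_
  rw [map_smul]
  have := hN.smul_mem _ _ _ ((h β p).1 hp j) _ (hf j)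
  rwa [show β - d j + (α + d j) = α + β by abel] at this

/-- Graded free modules have the lifting property with respect to degree-preserving maps. -/
theorem IsGradedFree.exists_lift {X Y : ModuleCat.{u} (MvPolynomial ι K)}
    {𝒳 : (ι → ℤ) → AddSubgroup X} {𝒴 : (ι → ℤ) → AddSubgroup Y} (h : IsGradedFree 𝒬 b d)
    (hX : IsGraded 𝒳) (hY : IsGraded 𝒴) {f : X ⟶ Y} (hf : IsHomogeneousMap 𝒳 𝒴 0 f) {g : P ⟶ Y}
    (hg : IsHomogeneousMap 𝒬 𝒴 0 g) (hgf : ∀ p, ∃ x, f.hom x = g.hom p) :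
    ∃ g' : P ⟶ X, IsHomogeneousMap 𝒬 𝒳 0 g' ∧ g' ≫ f = g := by
  have : ∀ j, ∃ x ∈ 𝒳 (d j), f.hom x = g.hom (b j) := fun j => by
    obtain ⟨x, hx⟩ := hgf (b j)
    have h1 := hf.exists_preimage hX hY (m := x) (α := d j)
      (by rw [hx]; exact hg.mem (h.basis_mem j))
    rwa [hx] at h1
  choose x hx hxg using this
  refine ⟨ModuleCat.ofHom (b.constr ℤ x), ?_, ?_⟩
  · rw [h.isHomogeneousMap_iff hX]
    intro j
    rw [zero_add, ModuleCat.hom_ofHom, b.constr_basis]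
    exact hx j
  · refine ModuleCat.hom_ext (b.ext fun j => ?_)
    rw [ModuleCat.hom_comp, LinearMap.comp_apply, ModuleCat.hom_ofHom, b.constr_basis, hxg]

theorem isGraded_omegaGrading : IsGraded (omegaGrading K ι) := by
  have : IsGradedFree (omegaGrading K ι)
      (Module.Basis.singleton Unit (MvPolynomial ι K)) (fun _ => 1) := by
    intro α p
    simp only [Module.Basis.singleton_repr, forall_const]
    rfl
  exact this.isGraded

/-- The dual `Hom_S(P, S)`. -/
abbrev dualModule (P : ModuleCat.{u} (MvPolynomial ι K)) : ModuleCat.{u} (MvPolynomial ι K) :=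
  ModuleCat.of (MvPolynomial ι K) (Module.Dual (MvPolynomial ι K) P)

/-- The grading of `Hom_S(P, ω)`. -/
def dualGrading (𝒬 : (ι → ℤ) → AddSubgroup P) : (ι → ℤ) → AddSubgroup (dualModule P) := fun α =>
  { carrier := {f : Module.Dual (MvPolynomial ι K) P |
      IsHomogeneousMap (N := polyModule K ι) 𝒬 (omegaGrading K ι) α (ModuleCat.ofHom f)}
    add_mem' := fun hf hg β m hm => add_mem (hf β m hm) (hg β m hm)
    zero_mem' := fun _ _ _ => zero_mem _
    neg_mem' := fun hf β m hm => neg_mem (hf β m hm) }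

/-- A form of degree `α` sends `b j` into `ω_(α + d j) = S_(α + d j - 1)`, and this value is its
coordinate at the dual basis vector. -/
theorem IsGradedFree.dual [Finite J] [DecidableEq J] (h : IsGradedFree 𝒬 b d) :
    IsGradedFree (P := dualModule P) (dualGrading 𝒬) b.dualBasis (fun j => 1 - d j) := by
  intro α f
  refine Iff.trans (h.isHomogeneousMap_iff isGraded_omegaGrading (α := α)
    (f := (ModuleCat.ofHom f : P ⟶ polyModule K ι))) (forall_congr' fun j => ?_)
  rw [Module.Basis.dualBasis_repr, sub_sub_eq_add_sub]
  rfl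

end Free

/-! ### Kernels and cokernels of squarefree modules -/

section Subquotient

variable {K : Type u} [Field K] {ι : Type} [Fintype ι] [DecidableEq ι]
  {M N : ModuleCat.{u} (MvPolynomial ι K)} {ℳ : (ι → ℤ) → AddSubgroup M}
  {𝒩 : (ι → ℤ) → AddSubgroup N}

/-- The kernel of a map of modules. -/
abbrev kerModule (f : M ⟶ N) : ModuleCat.{u} (MvPolynomial ι K) :=
  ModuleCat.of (MvPolynomial ι K) (LinearMap.ker f.hom)

/-- The grading of a kernel. -/
def kerGrading (ℳ : (ι → ℤ) → AddSubgroup M) (f : M ⟶ N) :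
    (ι → ℤ) → AddSubgroup (kerModule f) :=
  fun α => (ℳ α).comap (LinearMap.ker f.hom).subtype.toAddMonoidHom

theorem mem_kerGrading {f : M ⟶ N} {α : ι → ℤ} {z : LinearMap.ker f.hom} :
    z ∈ kerGrading ℳ f α ↔ (z : M) ∈ ℳ α := Iff.rfl

theorem isGraded_kerGrading (hM : IsGraded ℳ) (hN : IsGraded 𝒩) {f : M ⟶ N}
    (hf : IsHomogeneousMap ℳ 𝒩 0 f) : IsGraded (kerGrading ℳ f) := by
  refine ⟨?_, fun α β p hp m hm => hM.smul_mem α β p hp (m : LinearMap.ker f.hom) hm⟩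
  refine isInternal_of_injective hM.isInternal (LinearMap.ker f.hom).subtype.toAddMonoidHom
    Subtype.val_injective id Function.injective_id (fun α m hm => hm) ?_
  rintro ⟨m, hm⟩
  have key : ∀ α, component hM.isInternal α m ∈ LinearMap.ker f.hom := fun α => by
    rw [LinearMap.mem_ker, ← hf.component hM hN, LinearMap.mem_ker.1 hm, map_zero]
  obtain ⟨s, hs⟩ := exists_eq_sum_component hM.isInternal m
  have : (⟨m, hm⟩ : LinearMap.ker f.hom) = ∑ α ∈ s, ⟨component hM.isInternal α m, key α⟩ := by
    refine Subtype.ext ?_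
    rw [AddSubmonoidClass.coe_finsetSum]
    exact hs
  rw [this]
  exact sum_mem fun α _ => AddSubgroup.mem_iSup_of_mem α (component_mem hM.isInternal α m)

/-- If `z = x_i m` is killed by `f`, then `x_i f(m) = 0`, and injectivity of `x_i` on the target
forces `f(m) = 0`. So division by `x_i` stays inside the kernel. -/
theorem isSquarefree_kerGrading (hM : IsSquarefree ℳ) (hN : IsSquarefree 𝒩) {f : M ⟶ N}
    (hf : IsHomogeneousMap ℳ 𝒩 0 f) : IsSquarefree (kerGrading ℳ f) where
  isGraded := isGraded_kerGrading hM.isGraded hN.isGraded hf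
  finite := by
    have := hM.finite
    have : IsNoetherian (MvPolynomial ι K) M := isNoetherian_of_isNoetherianRing_of_finite _ _
    exact Module.IsNoetherian.finite _ _
  eq_bot α hα := by
    refine (AddSubgroup.eq_bot_iff_forall _).2 fun z hz => Subtype.ext ?_
    have := (mem_kerGrading (z := z)).1 hz
    rwa [hM.eq_bot α hα] at this
  bijOn α hα i hi := by
    refine bijOn_X_smul (isGraded_kerGrading hM.isGraded hN.isGraded hf) (fun z hz h => ?_)
      fun z hz => ?_
    · exact Subtype.ext (hM.eq_zero_of_X_smul hα hi hz (congrArg Subtype.val h))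
    · obtain ⟨m, hm, hmz⟩ := hM.exists_X_smul hα hi hz
      refine ⟨⟨m, ?_⟩, hm, Subtype.ext hmz⟩
      refine hN.eq_zero_of_X_smul hα hi (hf.mem hm) ?_
      rw [← map_smul, hmz]
      exact z.2

/-- The cokernel of a degree-preserving map of squarefree modules is squarefree. -/
theorem isSquarefree_of_surjective {L : ModuleCat.{u} (MvPolynomial ι K)}
    {ℒ : (ι → ℤ) → AddSubgroup L} (hL : IsSquarefree ℒ) (hM : IsSquarefree ℳ) {a : L ⟶ M}
    (ha : IsHomogeneousMap ℒ ℳ 0 a) (q : M ⟶ N) (hq : Function.Surjective q.hom)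
    (hker : ∀ m, q.hom m = 0 ↔ ∃ l, a.hom l = m)
    (hN : ∀ α n, n ∈ 𝒩 α ↔ ∃ m ∈ ℳ α, q.hom m = n) : IsSquarefree 𝒩 := by
  -- The kernel of `q` is the image of a degree-preserving map, hence closed under components; so
  -- components descend to `N`.
  have hcomp : ∀ m m', q.hom m = q.hom m' → ∀ α,
      q.hom (component hM.isGraded.isInternal α m) =
        q.hom (component hM.isGraded.isInternal α m') := by
    intro m m' h α
    rw [← sub_eq_zero, ← map_sub] at h
    obtain ⟨l, hl⟩ := (hker _).1 h
    rw [← sub_eq_zero, ← map_sub, ← map_sub, ← hl, ha.component hL.isGraded hM.isGraded]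
    exact (hker _).2 ⟨_, rfl⟩
  have hg : IsGraded 𝒩 := by
    constructor
    · refine isInternal_of_separating (fun α => AddMonoidHom.mk'
        (fun n => q.hom (component hM.isGraded.isInternal α (Function.surjInv hq n)))
        fun n n' => ?_) ?_ ?_ ?_
      · rw [← map_add, ← map_add]
        refine hcomp _ _ ?_ α
        rw [map_add, Function.surjInv_eq hq, Function.surjInv_eq hq, Function.surjInv_eq hq]
      · intro α β hαβ n hn
        obtain ⟨m, hm, rfl⟩ := (hN _ _).1 hn
        refine (hcomp _ m (Function.surjInv_eq hq _) α).trans ?_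
        rw [component_of_mem_ne _ hm hαβ, map_zero]
      · intro α n hn h0
        obtain ⟨m, hm, rfl⟩ := (hN _ _).1 hn
        have := (hcomp _ m (Function.surjInv_eq hq _) α).symm.trans h0
        rwa [component_of_mem _ hm] at this
      · intro n
        obtain ⟨m, rfl⟩ := hq n
        refine homogeneous_induction hM.isGraded.isInternal (C := fun m => q.hom m ∈ ⨆ α, 𝒩 α) m
          (fun α m hm => AddSubgroup.mem_iSup_of_mem α ((hN _ _).2 ⟨m, hm, rfl⟩)) ?_
          fun x y hx hy => ?_
        · rw [map_zero]
          exact zero_mem _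
        · rw [map_add]
          exact add_mem hx hy
    · intro α β p hp n hn
      obtain ⟨m, hm, rfl⟩ := (hN _ _).1 hn
      exact (hN _ _).2 ⟨p • m, hM.isGraded.smul_mem α β p hp m hm, map_smul _ _ _⟩
  refine ⟨hg, ?_, fun α hα => ?_, fun α hα i hi => bijOn_X_smul hg ?_ ?_⟩
  · have := hM.finite
    exact Module.Finite.of_surjective q.hom hq
  · refine (AddSubgroup.eq_bot_iff_forall _).2 fun n hn => ?_
    obtain ⟨m, hm, rfl⟩ := (hN _ _).1 hn
    rw [hM.eq_bot α hα, AddSubgroup.mem_bot] at hm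
    rw [hm, map_zero]
  · intro n hn h
    obtain ⟨m, hm, rfl⟩ := (hN _ _).1 hn
    rw [← map_smul] at h
    obtain ⟨l, hl⟩ := (hker _).1 h
    -- If `x_i m = a(l)`, take `l` homogeneous and divide it by `x_i` in `L`, say `l = x_i k`. Then
    -- `x_i` kills `a(k) - m`, so `m = a(k)`.
    obtain ⟨l', hl', hll⟩ := ha.exists_preimage hL.isGraded hM.isGraded (m := l)
      (α := α + Pi.single i 1) (by rw [hl]; exact hM.isGraded.X_smul_mem hm i)
    obtain ⟨k, hk, rfl⟩ := hL.exists_X_smul hα hi hl'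
    refine (hker _).2 ⟨k, ?_⟩
    rw [← sub_eq_zero]
    refine hM.eq_zero_of_X_smul hα hi (sub_mem (ha.mem hk) hm) ?_
    rw [smul_sub, ← map_smul, hll, hl, sub_self]
  · intro n hn
    obtain ⟨m, hm, rfl⟩ := (hN _ _).1 hn
    obtain ⟨m', hm', rfl⟩ := hM.exists_X_smul hα hi hm
    exact ⟨q.hom m', (hN _ _).2 ⟨m', hm', rfl⟩, (map_smul _ _ _).symm⟩

end Subquotient

/-! ### Free resolutions with generators in 0-1 degrees -/

section Resolution

variable {K : Type u} [Field K] {ι : Type} [Fintype ι] [DecidableEq ι]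
  {M : ModuleCat.{u} (MvPolynomial ι K)} {ℳ : (ι → ℤ) → AddSubgroup M}

/-- A graded free resolution by finitely generated modules with generators in squarefree
degrees. -/
structure FreeResolution (ℳ : (ι → ℤ) → AddSubgroup M) where
  J : ℕ → Type
  finite : ∀ k, Finite (J k)
  X : ℕ → ModuleCat.{u} (MvPolynomial ι K)
  gr : ∀ k, (ι → ℤ) → AddSubgroup (X k)
  basis : ∀ k, Module.Basis (J k) (MvPolynomial ι K) (X k)
  deg : ∀ k, J k → ι → ℤ
  isGradedFree : ∀ k, IsGradedFree (gr k) (basis k) (deg k)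
  deg_nonneg : ∀ k j, 0 ≤ deg k j
  deg_le_one : ∀ k j, deg k j ≤ 1
  d : ∀ k, X (k + 1) ⟶ X k
  π : X 0 ⟶ M
  d_mem : ∀ k, IsHomogeneousMap (gr (k + 1)) (gr k) 0 (d k)
  π_mem : IsHomogeneousMap (gr 0) ℳ 0 π
  π_surjective : Function.Surjective π.hom
  exact_zero : ∀ x, π.hom x = 0 ↔ ∃ y, (d 0).hom y = x
  exact_succ : ∀ k x, (d k).hom x = 0 ↔ ∃ y, (d (k + 1)).hom y = x

/-- Induction on a bound for the total degree: if `α i ≥ 2`, then `α - e_i` still has `i` in its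
support, so the element is `x_i` times one of degree `α - e_i`. Degrees with a negative coordinate
contribute only zero. -/
theorem IsSquarefree.mem_span (hM : IsSquarefree ℳ) (n : ℕ) {α : ι → ℤ} {m : M} (hm : m ∈ ℳ α)
    (hn : ∑ i, α i ≤ n) :
    m ∈ Submodule.span (MvPolynomial ι K) {m : M | ∃ α, 0 ≤ α ∧ α ≤ 1 ∧ m ∈ ℳ α} := by
  induction n generalizing α m with
  | zero =>
    by_cases hα : 0 ≤ α
    · refine Submodule.subset_span ⟨α, hα, fun i => ?_, hm⟩
      have := Finset.single_le_sum (f := α) (fun i _ => hα i) (Finset.mem_univ i)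
      exact (this.trans hn).trans (by simp)
    · rw [hM.eq_bot α hα, AddSubgroup.mem_bot] at hm
      rw [hm]
      exact zero_mem _
  | succ n ih =>
    by_cases hα : 0 ≤ α
    · by_cases h1 : α ≤ 1
      · exact Submodule.subset_span ⟨α, hα, h1, hm⟩
      · obtain ⟨i, hi⟩ := not_forall.1 h1
        have hi' : 1 < α i := not_le.1 hi
        have e : α - Pi.single i 1 + Pi.single i 1 = α := sub_add_cancel _ _
        obtain ⟨m', hm', rfl⟩ := hM.exists_X_smul (α := α - Pi.single i 1) (i := i) (m := m)
          (fun j => by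
            have := hα j
            by_cases hj : j = i
            · subst hj
              simp only [Pi.zero_apply, Pi.sub_apply, Pi.single_eq_same]
              lia
            · simpa [Pi.single_apply, hj] using this)
          (by simp only [Pi.sub_apply, Pi.single_eq_same]; lia) (by rwa [e])
        refine Submodule.smul_mem _ _ (ih hm' ?_)
        simp only [Pi.sub_apply, Finset.sum_sub_distrib, Finset.sum_pi_single', Finset.mem_univ,
          if_true]
        push_cast at hn
        lia
    · rw [hM.eq_bot α hα, AddSubgroup.mem_bot] at hm
      rw [hm]
      exact zero_mem _

theorem IsSquarefree.exists_generators (hM : IsSquarefree ℳ) :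
    ∃ (r : ℕ) (m : Fin r → M) (d : Fin r → ι → ℤ), (∀ j, 0 ≤ d j) ∧ (∀ j, d j ≤ 1) ∧
      (∀ j, m j ∈ ℳ (d j)) ∧ Submodule.span (MvPolynomial ι K) (Set.range m) = ⊤ := by
  have htop : Submodule.span (MvPolynomial ι K) {m : M | ∃ α, 0 ≤ α ∧ α ≤ 1 ∧ m ∈ ℳ α} = ⊤ := by
    refine eq_top_iff.2 fun m _ => ?_
    refine homogeneous_induction hM.isGraded.isInternal (C := fun m => m ∈ Submodule.span
      (MvPolynomial ι K) {m : M | ∃ α, 0 ≤ α ∧ α ≤ 1 ∧ m ∈ ℳ α}) m (fun α m hm => ?_)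
      (zero_mem _) fun x y hx hy => add_mem hx hy
    exact hM.mem_span (∑ i, α i).toNat hm (Int.self_le_toNat _)
  have hfg := hM.finite.fg_top
  rw [← htop] at hfg
  obtain ⟨s, hs, hspan⟩ := (Submodule.fg_span_iff_fg_span_finset_subset _).1 hfg
  choose d h0 h1 hd using fun x : s => hs x.2
  refine ⟨s.card, fun j => s.equivFin.symm j, fun j => d (s.equivFin.symm j), fun j => h0 _,
    fun j => h1 _, fun j => hd _, ?_⟩
  rw [← htop, hspan]
  congr 1
  rw [show (fun j => (s.equivFin.symm j : M)) = Subtype.val ∘ s.equivFin.symm from rfl,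
    s.equivFin.symm.surjective.range_comp]
  exact Subtype.range_coe

variable (K) in
/-- The free module with basis indexed by `J`. -/
abbrev freeModule (ι J : Type) : ModuleCat.{u} (MvPolynomial ι K) :=
  ModuleCat.of (MvPolynomial ι K) (J → MvPolynomial ι K)

variable (K) in
/-- The grading of a free module with generators of degrees `d j`. -/
def freeGrading {J : Type} (d : J → ι → ℤ) : (ι → ℤ) → AddSubgroup (freeModule K ι J) :=
  fun α => AddSubgroup.pi Set.univ fun j => (polyGrading K ι (α - d j)).toAddSubgroup

theorem isGradedFree_freeGrading {J : Type} [Finite J] (d : J → ι → ℤ) :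
    IsGradedFree (P := freeModule K ι J) (freeGrading K d)
      (Pi.basisFun (MvPolynomial ι K) J) d := by
  intro α p
  simp only [Pi.basisFun_repr]
  simp [freeGrading, AddSubgroup.mem_pi]

/-- A squarefree module with its grading. -/
structure SquarefreeModule (K : Type u) [Field K] (ι : Type) [Fintype ι] [DecidableEq ι] where
  carrier : ModuleCat.{u} (MvPolynomial ι K)
  gr : (ι → ℤ) → AddSubgroup carrier
  isSquarefree : IsSquarefree gr

/-- A presentation of a squarefree module as a quotient of a free module with generators in
squarefree degrees. -/
structure FreeCover (A : SquarefreeModule K ι) where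
  r : ℕ
  deg : Fin r → ι → ℤ
  deg_nonneg : ∀ j, 0 ≤ deg j
  deg_le_one : ∀ j, deg j ≤ 1
  p : freeModule K ι (Fin r) ⟶ A.carrier
  p_mem : IsHomogeneousMap (freeGrading K deg) A.gr 0 p
  surjective : Function.Surjective p.hom

theorem nonempty_freeCover (A : SquarefreeModule K ι) : Nonempty (FreeCover A) := by
  obtain ⟨r, m, d, h0, h1, hm, hspan⟩ := A.isSquarefree.exists_generators
  let b := Pi.basisFun (MvPolynomial ι K) (Fin r)
  refine ⟨⟨r, d, h0, h1, ModuleCat.ofHom (b.constr ℤ m), ?_, ?_⟩⟩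
  · rw [(isGradedFree_freeGrading d).isHomogeneousMap_iff A.isSquarefree.isGraded]
    intro j
    rw [ModuleCat.hom_ofHom, b.constr_basis, zero_add]
    exact hm j
  · rw [ModuleCat.hom_ofHom, ← LinearMap.range_eq_top, b.constr_range, hspan]

/-- A chosen cover by a free module. -/
def freeCover (A : SquarefreeModule K ι) : FreeCover A := (nonempty_freeCover A).some

/-- The syzygy module of the chosen cover. -/
def SquarefreeModule.syzygy (A : SquarefreeModule K ι) : SquarefreeModule K ι where
  carrier := kerModule (freeCover A).p
  gr := kerGrading (freeGrading K (freeCover A).deg) (freeCover A).p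
  isSquarefree := isSquarefree_kerGrading
    ((isGradedFree_freeGrading _).isSquarefree (freeCover A).deg_nonneg (freeCover A).deg_le_one)
    A.isSquarefree (freeCover A).p_mem

/-- The iterated syzygy modules. -/
def SquarefreeModule.syzygies (A : SquarefreeModule K ι) : ℕ → SquarefreeModule K ι
  | 0 => A
  | k + 1 => (A.syzygies k).syzygy

/-- The inclusion of a syzygy module. -/
def SquarefreeModule.syzygyι (A : SquarefreeModule K ι) :
    A.syzygy.carrier ⟶ freeModule K ι (Fin (freeCover A).r) :=
  ModuleCat.ofHom (LinearMap.ker (freeCover A).p.hom).subtype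

theorem SquarefreeModule.exact (A : SquarefreeModule K ι)
    (x : Fin (freeCover A).r → MvPolynomial ι K) :
    (freeCover A).p.hom x = 0 ↔
      ∃ y, ((freeCover A.syzygy).p ≫ A.syzygyι).hom y = x := by
  constructor
  · intro hx
    obtain ⟨y, hy⟩ := (freeCover A.syzygy).surjective ⟨x, hx⟩
    exact ⟨y, congrArg Subtype.val hy⟩
  · rintro ⟨y, rfl⟩
    exact ((freeCover A.syzygy).p.hom y).2

/-- The graded free resolution of a squarefree module. -/
def SquarefreeModule.freeResolution (A : SquarefreeModule K ι) : FreeResolution A.gr where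
  J k := Fin (freeCover (A.syzygies k)).r
  finite k := inferInstance
  X k := freeModule K ι (Fin (freeCover (A.syzygies k)).r)
  gr k := freeGrading K (freeCover (A.syzygies k)).deg
  basis k := Pi.basisFun _ _
  deg k := (freeCover (A.syzygies k)).deg
  isGradedFree k := isGradedFree_freeGrading _
  deg_nonneg k := (freeCover (A.syzygies k)).deg_nonneg
  deg_le_one k := (freeCover (A.syzygies k)).deg_le_one
  d k := (freeCover (A.syzygies k).syzygy).p ≫ (A.syzygies k).syzygyι
  π := (freeCover A).p
  d_mem k := (freeCover (A.syzygies k).syzygy).p_mem.comp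
    (isHomogeneousMap_zero_of fun α m hm => hm)
  π_mem := (freeCover A).p_mem
  π_surjective := (freeCover A).surjective
  exact_zero x := A.exact x
  -- The inclusion of a syzygy module is injective, so only the kernel of the covering map matters.
  exact_succ k x := Submodule.coe_eq_zero.trans ((A.syzygies k).syzygy.exact x)

namespace FreeResolution

variable (R : FreeResolution ℳ)

theorem d_comp_d (k : ℕ) : R.d (k + 1) ≫ R.d k = 0 :=
  ModuleCat.hom_ext (LinearMap.ext fun x => (R.exact_succ k _).2 ⟨x, rfl⟩)

theorem d_comp_π : R.d 0 ≫ R.π = 0 :=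
  ModuleCat.hom_ext (LinearMap.ext fun x => (R.exact_zero _).2 ⟨x, rfl⟩)

/-- The underlying chain complex. -/
def complex : ChainComplex (ModuleCat.{u} (MvPolynomial ι K)) ℕ :=
  ChainComplex.of R.X R.d R.d_comp_d

theorem complex_d (k : ℕ) : R.complex.d (k + 1) k = R.d k :=
  ChainComplex.of_d _ _ _

/-- The augmentation. -/
def augmentation : R.complex ⟶ (ChainComplex.single₀ (ModuleCat.{u} (MvPolynomial ι K))).obj M :=
  (ChainComplex.toSingle₀Equiv R.complex M).symm
    ⟨R.π, by rw [complex_d]; exact R.d_comp_π⟩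

theorem augmentation_f : R.augmentation.f 0 = R.π := by
  exact ChainComplex.toSingle₀Equiv_symm_apply_f_zero _ _

theorem quasiIso_augmentation : QuasiIso R.augmentation where
  quasiIsoAt k := by
    cases k with
    | zero =>
      rw [ChainComplex.quasiIsoAt₀_iff, ShortComplex.quasiIso_iff_of_zeros' _ rfl rfl rfl]
      constructor
      · rw [ShortComplex.moduleCat_exact_iff]
        intro x hx
        have hx' : R.π.hom x = 0 := by
          rw [← R.augmentation_f]
          exact hx
        obtain ⟨y, hy⟩ := (R.exact_zero x).1 hx'
        refine ⟨y, ?_⟩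
        rw [← R.complex_d] at hy
        exact hy
      · rw [ModuleCat.epi_iff_surjective]
        have := R.π_surjective
        rw [← R.augmentation_f] at this
        exact this
    | succ k =>
      rw [quasiIsoAt_iff_exactAt' (hL := ChainComplex.exactAt_succ_single_obj ..),
        HomologicalComplex.exactAt_iff' _ (k + 2) (k + 1) k (by simp) (by simp),
        ShortComplex.moduleCat_exact_iff]
      intro x hx
      have hx' : (R.d k).hom x = 0 := by
        rw [← R.complex_d]
        exact hx
      obtain ⟨y, hy⟩ := (R.exact_succ k x).1 hx'
      refine ⟨y, ?_⟩
      rw [← R.complex_d] at hy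
      exact hy

/-- The underlying projective resolution. -/
def projectiveResolution : ProjectiveResolution M where
  complex := R.complex
  projective k := by
    have : Module.Free (MvPolynomial ι K) (R.X k) := Module.Free.of_basis (R.basis k)
    exact ModuleCat.projective_of_categoryTheory_projective (R.X k)
  π := R.augmentation
  quasiIso := R.quasiIso_augmentation

theorem isGradedResolution : IsGradedResolution ℳ R.projectiveResolution R.gr where
  isGraded k := (R.isGradedFree k).isGraded
  d_mem k := by
    have := R.d_mem k
    rw [← R.complex_d] at this
    exact this
  π_mem := by
    have := R.π_mem
    rw [← R.augmentation_f] at this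
    exact this

end FreeResolution

end Resolution

/-! ### Classes of cocycles in `Ext` -/

section ProjectiveResolution

variable {A : Type u} [CommRing A] {M N : ModuleCat.{u} A}

theorem exists_d_eq_of_d_eq_zero (P : ProjectiveResolution M) (k : ℕ) (x : P.complex.X (k + 1))
    (hx : (P.complex.d (k + 1) k).hom x = 0) : ∃ y, (P.complex.d (k + 2) (k + 1)).hom y = x :=
  (ShortComplex.moduleCat_exact_iff _).1 (P.exact_succ k) x hx

theorem exists_d_eq_of_π_eq_zero (P : ProjectiveResolution M) (x : P.complex.X 0)
    (hx : (P.π.f 0).hom x = 0) : ∃ y, (P.complex.d 1 0).hom y = x :=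
  (ShortComplex.moduleCat_exact_iff
    (ShortComplex.mk _ _ P.complex_d_comp_π_f_zero)).1
    (ShortComplex.exact_of_g_is_cokernel _ P.isColimitCokernelCofork) x hx

theorem augmentation_surjective (P : ProjectiveResolution M) : Function.Surjective (P.π.f 0).hom :=
  (ModuleCat.epi_iff_surjective _).1 inferInstance

/-- Scaling by `r` is composition with `r • 𝟙 N`, on cocycles as well as on classes. -/
theorem smul_extMk (P : ProjectiveResolution M) {i : ℕ} (f : P.complex.X i ⟶ N) (m : ℕ)
    (hm : i + 1 = m) (hf : P.complex.d m i ≫ f = 0) (r : A) :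
    P.extMk (r • f) m hm (by rw [Linear.comp_smul, hf, smul_zero]) = r • P.extMk f m hm hf := by
  have := P.extMk_comp_mk₀ f m hm hf (r • 𝟙 N)
  rw [Abelian.Ext.mk₀_smul, Abelian.Ext.comp_smul, Abelian.Ext.comp_mk₀_id] at this
  rw [this]
  congr 1

theorem extMk_congr (P : ProjectiveResolution M) {i : ℕ} {f g : P.complex.X i ⟶ N} (h : f = g)
    (m : ℕ) (hm : i + 1 = m) (hf : P.complex.d m i ≫ f = 0) :
    P.extMk f m hm hf = P.extMk g m hm (h ▸ hf) := by
  subst h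
  rfl

theorem extMk_ofHom_smul (P : ProjectiveResolution M) {i : ℕ} (f : P.complex.X i →ₗ[A] N) (m : ℕ)
    (hm : i + 1 = m) (hf : P.complex.d m i ≫ ModuleCat.ofHom f = 0) (r : A)
    (hrf : P.complex.d m i ≫ ModuleCat.ofHom (r • f) = 0) :
    P.extMk (ModuleCat.ofHom (r • f)) m hm hrf = r • P.extMk (ModuleCat.ofHom f) m hm hf := by
  have h : (ModuleCat.ofHom (r • f) : P.complex.X i ⟶ N) = r • ModuleCat.ofHom f := rfl
  rw [extMk_congr P h]
  exact smul_extMk P _ _ _ hf r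

theorem extMk_ofHom_add (P : ProjectiveResolution M) {i : ℕ} (f g : P.complex.X i →ₗ[A] N) (m : ℕ)
    (hm : i + 1 = m) (hf : P.complex.d m i ≫ ModuleCat.ofHom f = 0)
    (hg : P.complex.d m i ≫ ModuleCat.ofHom g = 0)
    (hfg : P.complex.d m i ≫ ModuleCat.ofHom (f + g) = 0) :
    P.extMk (ModuleCat.ofHom (f + g)) m hm hfg =
      P.extMk (ModuleCat.ofHom f) m hm hf + P.extMk (ModuleCat.ofHom g) m hm hg := by
  have h : (ModuleCat.ofHom (f + g) : P.complex.X i ⟶ N) =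
    ModuleCat.ofHom f + ModuleCat.ofHom g := rfl
  rw [extMk_congr P h, P.add_extMk]

/-- There are no nonzero coboundaries in degree 0: they would factor through the term of
cohomological degree 1 of a complex concentrated in degrees `≤ 0`. -/
theorem extMk_zero_eq_zero_iff (P : ProjectiveResolution M) (f : P.complex.X 0 ⟶ N) (m : ℕ)
    (hm : 0 + 1 = m) (hf : P.complex.d m 0 ≫ f = 0) : P.extMk f m hm hf = 0 ↔ f = 0 := by
  rw [← P.extEquivCohomologyClass.apply_eq_iff_eq, P.extEquivCohomologyClass_extMk,
    P.extEquivCohomologyClass_zero, CochainComplex.HomComplex.CohomologyClass.mk_eq_zero_iff,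
    CochainComplex.HomComplex.Cocycle.toSingleMk_mem_coboundaries_iff _ _ _ _ _ 1 (by lia)]
  have h0 : Limits.IsZero (P.cochainComplex.X 1) :=
    CochainComplex.isZero_of_isStrictlyLE _ 0 _
  constructor
  · rintro ⟨g, hg⟩
    rw [h0.eq_zero_of_src g, Limits.comp_zero] at hg
    rw [← cancel_epi (P.cochainComplexXIso (-(0 : ℕ)) 0 rfl).hom, ← hg, Limits.comp_zero]
  · rintro rfl
    exact ⟨0, by rw [Limits.comp_zero, Limits.comp_zero]⟩

end ProjectiveResolution

/-! ### Comparison of resolutions and the grading of `Ext` -/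

namespace FreeResolution

variable {K : Type u} [Field K] {ι : Type} [Fintype ι] [DecidableEq ι]
  {M N : ModuleCat.{u} (MvPolynomial ι K)} {ℳ : (ι → ℤ) → AddSubgroup M}
  {𝒩 : (ι → ℤ) → AddSubgroup N} (R : FreeResolution ℳ)

section Comparison

variable {P : ProjectiveResolution M} {𝒬 : ∀ k : ℕ, (ι → ℤ) → AddSubgroup (P.complex.X k)}

theorem exists_lift_zero (hM : IsGraded ℳ) (hP : IsGradedResolution ℳ P 𝒬) :
    ∃ g : R.X 0 ⟶ P.complex.X 0, IsHomogeneousMap (R.gr 0) (𝒬 0) 0 g ∧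
      g ≫ (P.π.f 0 : P.complex.X 0 ⟶ M) = R.π :=
  (R.isGradedFree 0).exists_lift (Y := M) (hP.isGraded 0) hM hP.π_mem R.π_mem
    fun p => augmentation_surjective P _

theorem exists_lift_succ (hP : IsGradedResolution ℳ P 𝒬) (k : ℕ)
    {g : R.X k ⟶ P.complex.X k} (hg : IsHomogeneousMap (R.gr k) (𝒬 k) 0 g)
    (hgd : ∀ y, ∃ x, (P.complex.d (k + 1) k).hom x = (R.d k ≫ g).hom y) :
    ∃ g' : R.X (k + 1) ⟶ P.complex.X (k + 1),
      IsHomogeneousMap (R.gr (k + 1)) (𝒬 (k + 1)) 0 g' ∧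
      g' ≫ P.complex.d (k + 1) k = R.d k ≫ g :=
  (R.isGradedFree (k + 1)).exists_lift (hP.isGraded _) (hP.isGraded _) (hP.d_mem k)
    ((R.d_mem k).comp hg) hgd

/-- The degree-preserving maps in degree `k` that extend one step further. -/
def PartialLift (P : ProjectiveResolution M) (𝒬 : ∀ k : ℕ, (ι → ℤ) → AddSubgroup (P.complex.X k))
    (k : ℕ) : Type u :=
  {g : R.X k ⟶ P.complex.X k // IsHomogeneousMap (R.gr k) (𝒬 k) 0 g ∧
    ∀ y, ∃ x, (P.complex.d (k + 1) k).hom x = (R.d k ≫ g).hom y}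

theorem exists_partialLift_zero (hM : IsGraded ℳ) (hP : IsGradedResolution ℳ P 𝒬) :
    ∃ g : R.PartialLift P 𝒬 0, g.1 ≫ (P.π.f 0 : P.complex.X 0 ⟶ M) = R.π := by
  obtain ⟨g, hg, hgπ⟩ := R.exists_lift_zero hM hP
  refine ⟨⟨g, hg, fun y => exists_d_eq_of_π_eq_zero P _ ?_⟩, hgπ⟩
  exact (congrArg (fun h => h.hom ((R.d 0).hom y)) hgπ).trans ((R.exact_zero _).2 ⟨y, rfl⟩)

theorem exists_partialLift_succ (hP : IsGradedResolution ℳ P 𝒬) (k : ℕ)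
    (g : R.PartialLift P 𝒬 k) :
    ∃ g' : R.PartialLift P 𝒬 (k + 1), g'.1 ≫ P.complex.d (k + 1) k = R.d k ≫ g.1 := by
  obtain ⟨g', hg', hgd⟩ := R.exists_lift_succ hP k g.2.1 g.2.2
  refine ⟨⟨g', hg', fun y => exists_d_eq_of_d_eq_zero P k _ ?_⟩, hgd⟩
  have : ((R.d (k + 1) ≫ g') ≫ P.complex.d (k + 1) k).hom y = 0 := by
    rw [Category.assoc, hgd, ← Category.assoc, R.d_comp_d, Limits.zero_comp]
    rfl
  exact this

/-- A free resolution maps to any graded projective resolution by degree-preserving maps. -/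
theorem exists_hom (hM : IsGraded ℳ) (hP : IsGradedResolution ℳ P 𝒬) :
    ∃ φ : ProjectiveResolution.Hom R.projectiveResolution P (𝟙 M),
      ∀ k, IsHomogeneousMap (M := R.X k) (R.gr k) (𝒬 k) 0 (φ.hom.f k) := by
  obtain ⟨g0, hg0⟩ := R.exists_partialLift_zero hM hP
  choose next hnext using R.exists_partialLift_succ hP
  -- Since `PartialLift` carries the condition needed for the next lift, the chosen one-step
  -- extensions can be iterated by plain recursion.
  let g : ∀ k, R.PartialLift P 𝒬 k := fun k => Nat.rec g0 next k
  have hg : ∀ k, (g (k + 1)).1 ≫ P.complex.d (k + 1) k = R.d k ≫ (g k).1 := fun k => hnext k (g k)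
  refine ⟨⟨⟨fun k => (g k).1, ?_⟩, ?_⟩, fun k => (g k).2.1⟩
  · rintro _ j rfl
    refine (hg j).trans ?_
    exact congrArg (· ≫ (g j).1) (R.complex_d j).symm
  · rw [CategoryTheory.Functor.map_id, HomologicalComplex.id_f, Category.comp_id]
    exact hg0.trans R.augmentation_f.symm

end Comparison

/-- The cocycles in degree `i`. -/
def cocycles (i : ℕ) (N : ModuleCat.{u} (MvPolynomial ι K)) :
    Submodule (MvPolynomial ι K) (R.X i →ₗ[MvPolynomial ι K] N) :=
  LinearMap.ker (LinearMap.lcomp (MvPolynomial ι K) N (R.d i).hom)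

theorem mem_cocycles {i : ℕ} {f : R.X i →ₗ[MvPolynomial ι K] N} :
    f ∈ R.cocycles i N ↔ f.comp (R.d i).hom = 0 := Iff.rfl

theorem d_comp_ofHom {i : ℕ} {f : R.X i →ₗ[MvPolynomial ι K] N} (hf : f ∈ R.cocycles i N) :
    R.projectiveResolution.complex.d (i + 1) i ≫
      (ModuleCat.ofHom f : R.projectiveResolution.complex.X i ⟶ N) = 0 := by
  have h : R.d i ≫ ModuleCat.ofHom f = 0 := ModuleCat.hom_ext (R.mem_cocycles.1 hf)
  rw [← R.complex_d] at h
  exact h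

/-- The class in `Ext` of a cocycle. -/
def extClass (i : ℕ) (N : ModuleCat.{u} (MvPolynomial ι K)) :
    R.cocycles i N →ₗ[MvPolynomial ι K] extModule M N i where
  toFun f := R.projectiveResolution.extMk (ModuleCat.ofHom f.1) (i + 1) rfl (R.d_comp_ofHom f.2)
  map_add' f g := by
    have := extMk_ofHom_add R.projectiveResolution f.1 g.1 (i + 1) rfl (R.d_comp_ofHom f.2)
      (R.d_comp_ofHom g.2) (R.d_comp_ofHom (f + g).2)
    exact this
  map_smul' r f := by
    have := extMk_ofHom_smul R.projectiveResolution f.1 (i + 1) rfl (R.d_comp_ofHom f.2) r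
      (R.d_comp_ofHom (r • f).2)
    exact this

theorem extClass_surjective (i : ℕ) : Function.Surjective (R.extClass i N) := by
  intro e
  obtain ⟨f, hf, rfl⟩ := R.projectiveResolution.extMk_surjective e (i + 1) rfl
  refine ⟨⟨f.hom, ?_⟩, rfl⟩
  have h : R.complex.d (i + 1) i ≫ f = 0 := hf
  rw [R.complex_d] at h
  exact congrArg ModuleCat.Hom.hom h

theorem extClass_zero_eq_zero_iff (f : R.cocycles 0 N) : R.extClass 0 N f = 0 ↔ f.1 = 0 := by
  refine (extMk_zero_eq_zero_iff R.projectiveResolution _ _ rfl (R.d_comp_ofHom f.2)).trans ?_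
  exact ⟨fun h => congrArg ModuleCat.Hom.hom h, fun h => ModuleCat.hom_ext h⟩

theorem extClass_succ_eq_zero_iff (i : ℕ) (f : R.cocycles (i + 1) N) :
    R.extClass (i + 1) N f = 0 ↔
      ∃ g : R.X i →ₗ[MvPolynomial ι K] N, g.comp (R.d i).hom = f.1 := by
  refine (R.projectiveResolution.extMk_eq_zero_iff _ _ rfl (R.d_comp_ofHom f.2) i rfl).trans ?_
  constructor
  · rintro ⟨g, hg⟩
    have h : R.complex.d (i + 1) i ≫ g = ModuleCat.ofHom f.1 := hg
    rw [R.complex_d] at h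
    exact ⟨g.hom, congrArg ModuleCat.Hom.hom h⟩
  · rintro ⟨g, hg⟩
    have h : R.d i ≫ ModuleCat.ofHom g = ModuleCat.ofHom f.1 := ModuleCat.hom_ext hg
    rw [← R.complex_d] at h
    exact ⟨ModuleCat.ofHom g, h⟩

/-- The natural grading of `Ext` can be computed from a single free resolution. -/
theorem mem_extGrading_iff (hM : IsGraded ℳ) {i : ℕ} {α : ι → ℤ} {e : extModule M N i} :
    e ∈ extGrading ℳ 𝒩 i α ↔ ∃ f : R.cocycles i N,
      IsHomogeneousMap (R.gr i) 𝒩 α (ModuleCat.ofHom f.1) ∧ R.extClass i N f = e := by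
  constructor
  · intro he
    refine AddSubgroup.closure_induction (p := fun e _ => ∃ f : R.cocycles i N,
      IsHomogeneousMap (R.gr i) 𝒩 α (ModuleCat.ofHom f.1) ∧ R.extClass i N f = e)
      ?_ ?_ ?_ ?_ he
    · rintro _ ⟨P, 𝒬, hP, f, hf, hfα, rfl⟩
      -- Pulling `f` back along a degree-preserving lift of the identity of `M` changes neither its
      -- degree nor its class. All generators of the graded piece thus live on `R`, where they can
      -- be added.
      obtain ⟨φ, hφ⟩ := R.exists_hom hM hP
      have hdf : R.projectiveResolution.complex.d (i + 1) i ≫ φ.hom.f i ≫ f = 0 := by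
        rw [← φ.hom.comm_assoc, hf, Limits.comp_zero]
      refine ⟨⟨(φ.hom.f i ≫ f).hom, ?_⟩, ?_, ?_⟩
      · have h : R.complex.d (i + 1) i ≫ φ.hom.f i ≫ f = 0 := hdf
        rw [R.complex_d] at h
        exact congrArg ModuleCat.Hom.hom h
      · exact (hφ i).comp hfα
      · have := ProjectiveResolution.mk₀_comp_extMk f (i + 1) rfl hf φ
        rw [Abelian.Ext.mk₀_id_comp] at this
        exact this.symm
    · exact ⟨0, fun _ _ _ => zero_mem _, map_zero _⟩
    · rintro _ _ _ _ ⟨f, hf, rfl⟩ ⟨g, hg, rfl⟩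
      exact ⟨f + g, fun β m hm => add_mem (hf β m hm) (hg β m hm), map_add _ _ _⟩
    · rintro _ _ ⟨f, hf, rfl⟩
      exact ⟨-f, fun β m hm => neg_mem (hf β m hm), map_neg _ _⟩
  · rintro ⟨f, hf, rfl⟩
    exact AddSubgroup.subset_closure ⟨R.projectiveResolution, R.gr, R.isGradedResolution,
      ModuleCat.ofHom f.1, R.d_comp_ofHom f.2, hf, rfl⟩

end FreeResolution

/-! ### Degrees and monomials under restriction to `σ` -/

section Degrees

variable {K : Type u} [Field K] {ι : Type} [Fintype ι] [DecidableEq ι] {σ : Finset ι}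

theorem extendZero_apply (α : σ → ℤ) (i : σ) : extendZero σ α i = α i := by
  simp [extendZero]

theorem extendZero_of_notMem (α : σ → ℤ) {i : ι} (hi : i ∉ σ) : extendZero σ α i = 0 := by
  simp [extendZero, hi]

theorem extendZero_add (α β : σ → ℤ) :
    extendZero σ (α + β) = extendZero σ α + extendZero σ β := by
  funext i
  by_cases hi : i ∈ σ <;> simp [extendZero, hi]

theorem extendZero_injective : Function.Injective (extendZero σ) := fun α β h =>
  funext fun i => by rw [← extendZero_apply α, h, extendZero_apply]

variable (σ) in
/-- The degree in a module `M` of the elements of degree `α` of `𝔩_σ(M)`. -/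
def lDeg (α : σ → ℤ) : ι → ℤ := extendZero σ α + indicator σᶜ

theorem lDeg_injective : Function.Injective (lDeg σ) := fun _ _ h =>
  extendZero_injective (add_right_cancel h)

theorem lDeg_add (α β : σ → ℤ) : lDeg σ (α + β) = extendZero σ α + lDeg σ β := by
  rw [lDeg, lDeg, extendZero_add, add_assoc]

theorem natDeg_mapDomain (d : σ →₀ ℕ) :
    natDeg (d.mapDomain (Subtype.val : σ → ι)) = extendZero σ (natDeg d) := by
  funext i
  by_cases hi : i ∈ σ
  · rw [show extendZero σ (natDeg d) i = natDeg d ⟨i, hi⟩ from extendZero_apply _ ⟨i, hi⟩]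
    exact congrArg Nat.cast
      (Finsupp.mapDomain_apply (Subtype.val_injective (p := (· ∈ σ))) d ⟨i, hi⟩)
  · rw [extendZero_of_notMem _ hi, natDeg, Finsupp.mapDomain_of_notMem_range, Nat.cast_zero]
    rintro ⟨j, rfl⟩
    exact hi j.2

theorem inclusion_injective : Function.Injective (inclusion K σ) :=
  MvPolynomial.rename_injective _ Subtype.val_injective

theorem inclusion_mem {γ : σ → ℤ} {p : MvPolynomial σ K} (hp : p ∈ polyGrading K σ γ) :
    inclusion K σ p ∈ polyGrading K ι (extendZero σ γ) := by
  rw [mem_polyGrading_iff] at hp ⊢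
  intro d hd
  obtain ⟨u, rfl, hu⟩ := MvPolynomial.coeff_rename_ne_zero _ p d hd
  rw [natDeg_mapDomain, hp u hu]

theorem inclusion_mul_monomial_injective {e : ι →₀ ℕ} {p q : MvPolynomial σ K}
    (h : inclusion K σ p * MvPolynomial.monomial e 1 =
      inclusion K σ q * MvPolynomial.monomial e 1) : p = q := by
  refine inclusion_injective (mul_right_cancel₀ ?_ h)
  rw [Ne, MvPolynomial.monomial_eq_zero]
  exact one_ne_zero

/-- In a nonnegative degree the piece is spanned by a single monomial. As `e` vanishes on `σ`,
nonnegativity gives `0 ≤ γ`, and that monomial is `x^γ x^e`. -/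
theorem exists_inclusion_mul_monomial {γ : σ → ℤ} {e : ι →₀ ℕ} (he : ∀ i ∈ σ, e i = 0)
    {p : MvPolynomial ι K} (hp : p ∈ polyGrading K ι (extendZero σ γ + natDeg e)) :
    ∃ v ∈ polyGrading K σ γ, inclusion K σ v * MvPolynomial.monomial e 1 = p := by
  by_cases h0 : 0 ≤ extendZero σ γ + natDeg e
  · have hγ : 0 ≤ γ := fun i => by
      have := h0 i
      simpa [extendZero_apply, natDeg, he i i.2] using this
    obtain ⟨u, rfl⟩ := exists_natDeg_eq hγ
    rw [← natDeg_mapDomain, ← natDeg_add] at hp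
    refine ⟨MvPolynomial.monomial u (p.coeff (u.mapDomain Subtype.val + e)),
      monomial_mem_polyGrading _ _, ?_⟩
    conv_rhs => rw [eq_monomial_of_mem hp]
    refine (congrArg (· * _) (MvPolynomial.rename_monomial _ _ _)).trans ?_
    rw [MvPolynomial.monomial_mul, mul_one]
  · exact ⟨0, zero_mem _, by rw [eq_zero_of_mem_of_not_nonneg hp h0, map_zero, zero_mul]⟩

theorem inclusion_mul_monomial_mem_iff {γ : σ → ℤ} {e : ι →₀ ℕ} (he : ∀ i ∈ σ, e i = 0)
    {v : MvPolynomial σ K} :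
    inclusion K σ v * MvPolynomial.monomial e 1 ∈ polyGrading K ι (extendZero σ γ + natDeg e) ↔
      v ∈ polyGrading K σ γ := by
  refine ⟨fun h => ?_, fun h => mul_mem_polyGrading (inclusion_mem h)
    (monomial_mem_polyGrading e 1)⟩
  obtain ⟨v', hv', h'⟩ := exists_inclusion_mul_monomial he h
  rwa [← inclusion_mul_monomial_injective h']

variable (σ) in
/-- The restriction to `σ` of a degree. -/
def resDeg (δ : ι → ℤ) : σ → ℤ := fun i => δ i

variable (σ) in
/-- The exponent vector `σᶜ - δ|_{σᶜ}`, for a 0-1 vector `δ`. -/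
def lExp (δ : ι → ℤ) : ι →₀ ℕ :=
  Finsupp.equivFunOnFinite.symm fun i => if i ∈ σ then 0 else (1 - δ i).toNat

theorem lExp_of_mem (δ : ι → ℤ) {i : ι} (hi : i ∈ σ) : lExp σ δ i = 0 := by
  simp [lExp, hi]

/-- Off `σ` the coordinates are `(1 - δ) + δ = 1`, the truncation being harmless for `δ ≤ 1`; on `σ`
only `δ` remains. -/
theorem natDeg_lExp_add {δ : ι → ℤ} (h1 : δ ≤ 1) :
    natDeg (lExp σ δ) + δ = lDeg σ (resDeg σ δ) := by
  funext i
  have := h1 i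
  by_cases hi : i ∈ σ
  · simp [natDeg, lExp, lDeg, extendZero, indicator, resDeg, hi]
  · simp only [Pi.one_apply] at this
    simp [natDeg, lExp, lDeg, extendZero, indicator, hi, this]

theorem lDeg_sub {δ : ι → ℤ} (h1 : δ ≤ 1) (α : σ → ℤ) :
    lDeg σ α - δ = extendZero σ (α - resDeg σ δ) + natDeg (lExp σ δ) := by
  rw [sub_eq_iff_eq_add, add_assoc, natDeg_lExp_add h1, ← lDeg_add, sub_add_cancel]

end Degrees

/-! ### The functor `𝔩_σ` and its exactness -/

section LFunctor

variable {K : Type u} [Field K] {ι : Type} [Fintype ι] [DecidableEq ι] {σ : Finset ι}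
  {M N : ModuleCat.{u} (MvPolynomial ι K)} {ℳ : (ι → ℤ) → AddSubgroup M}
  {𝒩 : (ι → ℤ) → AddSubgroup N}

/-- The inclusion `𝔩_σ(M) → M`. -/
def lVal (ℳ : (ι → ℤ) → AddSubgroup M) (σ : Finset ι) : lModule ℳ σ →+ M :=
  (restrictSubmodule (shift ℳ (indicator σᶜ)) σ).subtype.toAddMonoidHom

theorem lVal_injective : Function.Injective (lVal ℳ σ) := Subtype.val_injective

theorem lVal_smul (r : MvPolynomial σ K) (x : lModule ℳ σ) :
    lVal ℳ σ (r • x) = inclusion K σ r • lVal ℳ σ x := rfl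

/-- The elements of `M` that lie in `𝔩_σ(M)`. -/
def InL (ℳ : (ι → ℤ) → AddSubgroup M) (σ : Finset ι) (m : M) : Prop := m ∈ restrictSubmodule (shift ℳ (indicator σᶜ)) σ

theorem inL_lVal (x : lModule ℳ σ) : InL ℳ σ (lVal ℳ σ x) := x.2

theorem InL.exists_lVal_eq {m : M} (h : InL ℳ σ m) : ∃ x, lVal ℳ σ x = m := ⟨⟨m, h⟩, rfl⟩

theorem InL.zero : InL ℳ σ 0 := zero_mem (restrictSubmodule (shift ℳ (indicator σᶜ)) σ)

theorem InL.add {m m' : M} (h : InL ℳ σ m) (h' : InL ℳ σ m') : InL ℳ σ (m + m') :=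
  add_mem (S := Submodule (MvPolynomial σ K) ((ModuleCat.restrictScalars (inclusion K σ)).obj M))
    h h'

theorem inL_of_mem {α : σ → ℤ} (hα : 0 ≤ α) {m : M} (hm : m ∈ ℳ (lDeg σ α)) : InL ℳ σ m :=
  Submodule.subset_span ⟨α, hα, hm⟩

theorem mem_lGrading_iff {α : σ → ℤ} (hα : 0 ≤ α) {x : lModule ℳ σ} :
    x ∈ lGrading ℳ σ α ↔ lVal ℳ σ x ∈ ℳ (lDeg σ α) := by
  rw [lGrading, restrictGrading, if_pos hα]
  rfl

theorem eq_zero_of_mem_lGrading {α : σ → ℤ} (hα : ¬ 0 ≤ α) {x : lModule ℳ σ}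
    (hx : x ∈ lGrading ℳ σ α) : x = 0 := by
  rwa [lGrading, restrictGrading, if_neg hα, AddSubgroup.mem_bot] at hx

theorem lVal_mem {α : σ → ℤ} {x : lModule ℳ σ} (hx : x ∈ lGrading ℳ σ α) :
    lVal ℳ σ x ∈ ℳ (lDeg σ α) := by
  by_cases hα : 0 ≤ α
  · exact (mem_lGrading_iff hα).1 hx
  · rw [eq_zero_of_mem_lGrading hα hx, map_zero]
    exact zero_mem _

/-- The degrees `lDeg σ α` with `0 ≤ α` are stable under adding degrees of monomials of `K[σ]`, so
the action of `K[σ]` creates no component outside them. -/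
theorem component_inclusion_smul_eq_zero (hM : IsGraded ℳ) {m : M}
    (hm : ∀ β : ι → ℤ, (∀ α : σ → ℤ, 0 ≤ α → lDeg σ α ≠ β) → component hM.isInternal β m = 0)
    (r : MvPolynomial σ K) (β : ι → ℤ) (hβ : ∀ α : σ → ℤ, 0 ≤ α → lDeg σ α ≠ β) :
    component hM.isInternal β (inclusion K σ r • m) = 0 := by
  refine polynomial_induction (C := fun r => component hM.isInternal β
    (inclusion K σ r • m) = 0) r (fun γ r hr => ?_) fun p q hp hq => ?_
  · by_cases hγ : 0 ≤ γ
    · have := component_map hM.isInternal hM.isInternal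
        (DistribSMul.toAddMonoidHom M (inclusion K σ r)) (fun β => extendZero σ γ + β)
        (add_right_injective _) (fun β m hm => hM.smul_mem _ _ _ (inclusion_mem hr) m hm)
        (β - extendZero σ γ) m
      simp only [add_sub_cancel, DistribSMul.toAddMonoidHom_apply] at this
      rw [this, hm, smul_zero]
      intro α hα hαβ
      refine hβ (γ + α) (add_nonneg hγ hα) ?_
      rw [lDeg_add, hαβ, add_sub_cancel]
    · rw [eq_zero_of_mem_of_not_nonneg hr hγ, map_zero, zero_smul, map_zero]
  · rw [map_add, add_smul, map_add, hp, hq, add_zero]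

/-- This turns the definition of `𝔩_σ(M)` as a span into a condition on the support, by induction on
the span. -/
theorem InL.component_eq_zero (hM : IsGraded ℳ) {m : M} (h : InL ℳ σ m) (β : ι → ℤ)
    (hβ : ∀ α : σ → ℤ, 0 ≤ α → lDeg σ α ≠ β) : component hM.isInternal β m = 0 := by
  refine Submodule.span_induction
    (M := (ModuleCat.restrictScalars (inclusion K σ)).obj M)
    (p := fun m _ => ∀ β : ι → ℤ, (∀ α : σ → ℤ, 0 ≤ α → lDeg σ α ≠ β) →
      component hM.isInternal β (m : M) = 0) ?_ ?_ ?_ ?_ h β hβ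
  · rintro m ⟨α, hα, hm⟩ β hβ
    exact component_of_mem_ne hM.isInternal hm (hβ α hα).symm
  · intro β _
    exact map_zero _
  · intro x y _ _ hx hy β hβ
    exact ((component hM.isInternal β).map_add (x : M) y).trans
      ((congrArg₂ _ (hx β hβ) (hy β hβ)).trans (add_zero (0 : M)))
  · intro r x _ hx β hβ
    exact component_inclusion_smul_eq_zero hM (m := x) hx r β hβ

theorem InL.component (hM : IsGraded ℳ) {m : M} (h : InL ℳ σ m) (β : ι → ℤ) :
    InL ℳ σ (component hM.isInternal β m) := by
  by_cases hβ : ∃ α : σ → ℤ, 0 ≤ α ∧ lDeg σ α = β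
  · obtain ⟨α, hα, rfl⟩ := hβ
    exact inL_of_mem hα (component_mem _ _ _)
  · rw [h.component_eq_zero hM β fun α hα h => hβ ⟨α, hα, h⟩]
    exact InL.zero

theorem inL_of_component (hM : IsGraded ℳ) {m : M}
    (h : ∀ β, InL ℳ σ (Multigraded.component hM.isInternal β m)) : InL ℳ σ m :=
  component_induction hM.isInternal m h InL.zero fun _ _ hx hy => hx.add hy

/-- The components of an element of `𝔩_σ(M)` lie in `𝔩_σ(M)` again, and those outside the degrees
`lDeg σ α`, `0 ≤ α`, vanish. -/
theorem lModule_induction (hM : IsGraded ℳ) {C : lModule ℳ σ → Prop} (x : lModule ℳ σ)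
    (hC : ∀ α, 0 ≤ α → ∀ x ∈ lGrading ℳ σ α, C x) (h0 : C 0)
    (hadd : ∀ x y, C x → C y → C (x + y)) : C x := by
  have key : ∀ m : M, (∀ β, InL ℳ σ (component hM.isInternal β m)) →
      ∀ x, lVal ℳ σ x = m → C x := by
    intro m hm
    obtain ⟨s, hs⟩ := exists_eq_sum_component hM.isInternal m
    intro x hx
    choose y hy using fun β => (hm β).exists_lVal_eq
    have : x = ∑ β ∈ s, y β := lVal_injective (by
      rw [hx, map_sum]
      simp only [hy]
      exact hs)
    rw [this]
    refine Finset.sum_induction _ C hadd h0 fun β _ => ?_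
    by_cases hβ : ∃ α : σ → ℤ, 0 ≤ α ∧ lDeg σ α = β
    · obtain ⟨α, hα, rfl⟩ := hβ
      refine hC α hα _ ((mem_lGrading_iff hα).2 ?_)
      rw [hy]
      exact component_mem _ _ _
    · have : y β = 0 := lVal_injective (by
        rw [hy, map_zero, ← hx]
        exact (inL_lVal x).component_eq_zero hM β fun α hα h => hβ ⟨α, hα, h⟩)
      rw [this]
      exact h0
  exact key _ (fun β => (inL_lVal x).component hM β) x rfl

theorem isGraded_lGrading (hM : IsGraded ℳ) : IsGraded (lGrading ℳ σ) := by
  constructor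
  · refine isInternal_of_injective hM.isInternal (lVal ℳ σ) lVal_injective (lDeg σ)
      lDeg_injective (fun α x hx => lVal_mem hx) fun x => ?_
    exact lModule_induction hM (C := fun x => x ∈ ⨆ α, lGrading ℳ σ α) x
      (fun α _ x hx => AddSubgroup.mem_iSup_of_mem α hx) (zero_mem _) fun x y hx hy => add_mem hx hy
  · intro α β r hr x hx
    by_cases hβ : 0 ≤ β
    · by_cases hα : 0 ≤ α
      · rw [mem_lGrading_iff (add_nonneg hα hβ), lVal_smul, lDeg_add]
        exact hM.smul_mem _ _ _ (inclusion_mem hr) _ (lVal_mem hx)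
      · rw [eq_zero_of_mem_of_not_nonneg hr hα, zero_smul]
        exact zero_mem _
    · rw [eq_zero_of_mem_lGrading hβ hx, smul_zero]
      exact zero_mem _

theorem IsHomogeneousMap.inL {f : M ⟶ N} (hf : IsHomogeneousMap ℳ 𝒩 0 f) (hM : IsGraded ℳ)
    {m : M} (hm : InL ℳ σ m) : InL 𝒩 σ (f.hom m) := by
  obtain ⟨x, rfl⟩ := hm.exists_lVal_eq
  refine lModule_induction hM (C := fun x => InL 𝒩 σ (f.hom (lVal ℳ σ x))) x
    (fun α hα x hx => inL_of_mem hα (hf.mem (lVal_mem hx))) ?_ fun x y hx hy => ?_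
  · rw [map_zero, map_zero]
    exact InL.zero
  · rw [map_add, map_add]
    exact hx.add hy

/-- The map `𝔩_σ(f)`. -/
def lMap (σ : Finset ι) (hM : IsGraded ℳ) {f : M ⟶ N} (hf : IsHomogeneousMap ℳ 𝒩 0 f) :
    lModule ℳ σ ⟶ lModule 𝒩 σ :=
  ModuleCat.ofHom
    { toFun := fun x => (⟨f.hom (lVal ℳ σ x), hf.inL hM (inL_lVal x)⟩ :
        restrictSubmodule (shift 𝒩 (indicator σᶜ)) σ)
      map_add' := fun x y => Subtype.ext <|
        show f.hom (lVal ℳ σ (x + y)) = f.hom (lVal ℳ σ x) + f.hom (lVal ℳ σ y) by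
          rw [map_add, map_add]
      map_smul' := fun r x => Subtype.ext <|
        show f.hom (lVal ℳ σ (r • x)) = inclusion K σ r • f.hom (lVal ℳ σ x) by
          rw [lVal_smul, map_smul] }

theorem lVal_lMap (hM : IsGraded ℳ) {f : M ⟶ N} (hf : IsHomogeneousMap ℳ 𝒩 0 f)
    (x : lModule ℳ σ) : lVal 𝒩 σ ((lMap σ hM hf).hom x) = f.hom (lVal ℳ σ x) := rfl

theorem isHomogeneousMap_lMap (hM : IsGraded ℳ) {f : M ⟶ N} (hf : IsHomogeneousMap ℳ 𝒩 0 f) :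
    IsHomogeneousMap (lGrading ℳ σ) (lGrading 𝒩 σ) 0 (lMap σ hM hf) := by
  refine isHomogeneousMap_zero_of fun α x hx => ?_
  by_cases hα : 0 ≤ α
  · rw [mem_lGrading_iff hα, lVal_lMap]
    exact hf.mem (lVal_mem hx)
  · rw [eq_zero_of_mem_lGrading hα hx, map_zero]
    exact zero_mem _

/-- An element of `𝔩_σ(N)` in the image of a degree-preserving map `M → N` comes from
`𝔩_σ(M)`. -/
theorem exists_lMap_eq (hM : IsGraded ℳ) (hN : IsGraded 𝒩) {f : M ⟶ N}
    (hf : IsHomogeneousMap ℳ 𝒩 0 f) {y : lModule 𝒩 σ} {m : M} (h : f.hom m = lVal 𝒩 σ y) :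
    ∃ x, (lMap σ hM hf).hom x = y := by
  -- Lift degree by degree: in a degree selected by `𝔩_σ` the component of `m` works, and in all
  -- others `y` has no component.
  have key : ∀ β, ∃ x, f.hom (lVal ℳ σ x) = component hN.isInternal β (lVal 𝒩 σ y) := fun β => by
    by_cases hβ : ∃ α : σ → ℤ, 0 ≤ α ∧ lDeg σ α = β
    · obtain ⟨α, hα, rfl⟩ := hβ
      obtain ⟨x, hx⟩ := (inL_of_mem (ℳ := ℳ) hα
        (component_mem hM.isInternal (lDeg σ α) m)).exists_lVal_eq
      exact ⟨x, by rw [hx, ← hf.component hM hN, h]⟩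
    · refine ⟨0, ?_⟩
      rw [map_zero, map_zero,
        (inL_lVal y).component_eq_zero hN β fun α hα h => hβ ⟨α, hα, h⟩]
  choose x hx using key
  obtain ⟨s, hs⟩ := exists_eq_sum_component hN.isInternal (lVal 𝒩 σ y)
  refine ⟨∑ β ∈ s, x β, lVal_injective ?_⟩
  rw [lVal_lMap, map_sum, map_sum]
  simp only [hx]
  exact hs.symm

end LFunctor

/-! ### `𝔩_σ` of graded free modules -/

section LFree

variable {K : Type u} [Field K] {ι : Type} [Fintype ι] [DecidableEq ι] {σ : Finset ι}
  {P : ModuleCat.{u} (MvPolynomial ι K)} {J : Type} {𝒬 : (ι → ℤ) → AddSubgroup P}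
  {b : Module.Basis J (MvPolynomial ι K) P} {d : J → ι → ℤ}

/-- The generators `x^(σᶜ - d)b` of `𝔩_σ(P)`, for a graded free module `P`. -/
theorem exists_lGenerator (h : IsGradedFree 𝒬 b d) (h0 : ∀ j, 0 ≤ d j) (h1 : ∀ j, d j ≤ 1)
    (j : J) : ∃ x, lVal 𝒬 σ x = (MvPolynomial.monomial (lExp σ (d j)) (1 : K)) • b j := by
  refine InL.exists_lVal_eq (inL_of_mem (α := resDeg σ (d j)) (fun i => h0 j i) ?_)
  rw [← natDeg_lExp_add (h1 j)]
  exact h.smul_mem (monomial_mem_polyGrading _ _) (h.basis_mem j)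

/-- A basis of `𝔩_σ(P)`, for a graded free module `P`. -/
theorem exists_lBasis [Finite J] (h : IsGradedFree 𝒬 b d) (h0 : ∀ j, 0 ≤ d j)
    (h1 : ∀ j, d j ≤ 1) : ∃ b' : Module.Basis J (MvPolynomial σ K) (lModule 𝒬 σ),
      ∀ x j, b.repr (lVal 𝒬 σ x) j =
        inclusion K σ (b'.repr x j) * MvPolynomial.monomial (lExp σ (d j)) 1 := by
  choose g hg using fun j => exists_lGenerator (σ := σ) h h0 h1 j
  -- Comparing coordinates over `S` reduces independence to cancelling a monomial, and spanning to
  -- dividing homogeneous coordinates by it.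
  have hlc : ∀ (l : J →₀ MvPolynomial σ K) (j : J),
      b.repr (lVal 𝒬 σ (Finsupp.linearCombination (MvPolynomial σ K) g l)) j =
        inclusion K σ (l j) * MvPolynomial.monomial (lExp σ (d j)) 1 := by
    intro l j
    induction l using Finsupp.induction_linear with
    | zero => simp
    | add l l' hl hl' =>
      rw [map_add, map_add, map_add, Finsupp.add_apply, hl, hl', Finsupp.add_apply, map_add,
        add_mul]
    | single k r =>
      classical
      rw [Finsupp.linearCombination_single, lVal_smul, hg, map_smul, map_smul, b.repr_self,
        Finsupp.smul_apply, Finsupp.smul_apply, Finsupp.single_apply, Finsupp.single_apply]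
      split_ifs with hkj
      · subst hkj
        simp
      · simp
  have hli : LinearIndependent (MvPolynomial σ K) g := by
    rw [linearIndependent_iff]
    intro l hl
    ext1 j
    refine inclusion_mul_monomial_injective (e := lExp σ (d j)) ?_
    rw [← hlc, hl]
    simp
  have hspan : ⊤ ≤ Submodule.span (MvPolynomial σ K) (Set.range g) := by
    intro x _
    refine lModule_induction h.isGraded
      (C := fun x => x ∈ Submodule.span (MvPolynomial σ K) (Set.range g)) x (fun α hα x hx => ?_)
      (zero_mem _) fun x y hx hy => add_mem hx hy
    have hx' := (h _ _).1 (lVal_mem hx)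
    have : ∀ j, ∃ v, inclusion K σ v * MvPolynomial.monomial (lExp σ (d j)) 1 =
        b.repr (lVal 𝒬 σ x) j := fun j => by
      have := hx' j
      rw [lDeg_sub (h1 j)] at this
      obtain ⟨v, _, hv⟩ := exists_inclusion_mul_monomial (fun i hi => lExp_of_mem _ hi) this
      exact ⟨v, hv⟩
    choose v hv using this
    rw [← Finsupp.range_linearCombination]
    refine ⟨Finsupp.equivFunOnFinite.symm v, lVal_injective (b.repr.injective ?_)⟩
    ext1 j
    rw [hlc, ← hv]
    rfl
  refine ⟨Module.Basis.mk hli hspan, fun x j => ?_⟩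
  rw [← hlc]
  congr 3
  conv_lhs => rw [← (Module.Basis.mk hli hspan).linearCombination_repr x]
  rw [Module.Basis.coe_mk]

/-- The basis of `𝔩_σ(P)` formed by the elements `x^(σᶜ - d)b`. -/
def lBasis [Finite J] (σ : Finset ι) (h : IsGradedFree 𝒬 b d) (h0 : ∀ j, 0 ≤ d j)
    (h1 : ∀ j, d j ≤ 1) : Module.Basis J (MvPolynomial σ K) (lModule 𝒬 σ) :=
  (exists_lBasis h h0 h1).choose

theorem repr_lVal [Finite J] (h : IsGradedFree 𝒬 b d) (h0 : ∀ j, 0 ≤ d j)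
    (h1 : ∀ j, d j ≤ 1) (x : lModule 𝒬 σ) (j : J) :
    b.repr (lVal 𝒬 σ x) j = inclusion K σ ((lBasis σ h h0 h1).repr x j) *
      MvPolynomial.monomial (lExp σ (d j)) 1 :=
  (exists_lBasis h h0 h1).choose_spec x j

theorem lVal_lBasis [Finite J] (h : IsGradedFree 𝒬 b d) (h0 : ∀ j, 0 ≤ d j)
    (h1 : ∀ j, d j ≤ 1) (j : J) :
    lVal 𝒬 σ (lBasis σ h h0 h1 j) = MvPolynomial.monomial (lExp σ (d j)) (1 : K) • b j := by
  classical
  refine b.repr.injective (Finsupp.ext fun k => ?_)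
  rw [repr_lVal h h0 h1, Module.Basis.repr_self, map_smul, b.repr_self, Finsupp.smul_apply,
    Finsupp.single_apply, Finsupp.single_apply]
  split_ifs with hjk
  · subst hjk
    simp
  · simp

theorem isGradedFree_lGrading [Finite J] (h : IsGradedFree 𝒬 b d) (h0 : ∀ j, 0 ≤ d j)
    (h1 : ∀ j, d j ≤ 1) :
    IsGradedFree (lGrading 𝒬 σ) (lBasis σ h h0 h1) (fun j => resDeg σ (d j)) := by
  intro α x
  by_cases hα : 0 ≤ α
  · rw [mem_lGrading_iff hα, h]
    refine forall_congr' fun j => ?_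
    rw [repr_lVal h h0 h1, lDeg_sub (h1 j)]
    exact inclusion_mul_monomial_mem_iff fun i hi => lExp_of_mem _ hi
  · constructor
    · intro hx j
      rw [eq_zero_of_mem_lGrading hα hx, map_zero]
      exact zero_mem _
    · intro hx
      -- For `α` not nonnegative the piece is zero by definition. The coordinates vanish too: `0 ≤ d
      -- j` implies that `α - d j` restricted to `σ` is not nonnegative.
      have : x = 0 := by
        refine (lBasis σ h h0 h1).repr.map_eq_zero_iff.1 (Finsupp.ext fun j => ?_)
        refine eq_zero_of_mem_of_not_nonneg (hx j) fun h' => hα fun i => ?_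
        have h2 := h' i
        have h3 := h0 j i
        simp only [Pi.zero_apply, Pi.sub_apply, resDeg] at h2 h3 ⊢
        lia
      rw [this]
      exact zero_mem _

end LFree

/-! ### `𝔩_σ` of a resolution -/

section LResolution

variable {K : Type u} [Field K] {ι : Type} [Fintype ι] [DecidableEq ι]
  {M : ModuleCat.{u} (MvPolynomial ι K)} {ℳ : (ι → ℤ) → AddSubgroup M}

/-- The functor `𝔩_σ` maps free resolutions to free resolutions. -/
def FreeResolution.restrict (R : FreeResolution ℳ) (hM : IsGraded ℳ) (σ : Finset ι) :
    FreeResolution (lGrading ℳ σ) where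
  J := R.J
  finite := R.finite
  X k := lModule (R.gr k) σ
  gr k := lGrading (R.gr k) σ
  basis k := have := R.finite k; lBasis σ (R.isGradedFree k) (R.deg_nonneg k) (R.deg_le_one k)
  deg k j := resDeg σ (R.deg k j)
  isGradedFree k := have := R.finite k; isGradedFree_lGrading _ _ _
  deg_nonneg k j i := R.deg_nonneg k j i
  deg_le_one k j i := R.deg_le_one k j i
  d k := lMap σ (R.isGradedFree (k + 1)).isGraded (R.d_mem k)
  π := lMap σ (R.isGradedFree 0).isGraded R.π_mem
  d_mem k := isHomogeneousMap_lMap _ _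
  π_mem := isHomogeneousMap_lMap _ _
  π_surjective y := by
    obtain ⟨m, hm⟩ := R.π_surjective (lVal ℳ σ y)
    exact exists_lMap_eq (R.isGradedFree 0).isGraded hM R.π_mem hm
  exact_zero x := by
    rw [← lVal_injective.eq_iff, lVal_lMap, map_zero, R.exact_zero]
    constructor
    · rintro ⟨y, hy⟩
      exact exists_lMap_eq (R.isGradedFree 1).isGraded (R.isGradedFree 0).isGraded (R.d_mem 0) hy
    · rintro ⟨y, rfl⟩
      exact ⟨_, (lVal_lMap _ _ y).symm⟩
  exact_succ k x := by
    rw [← lVal_injective.eq_iff, lVal_lMap, map_zero, R.exact_succ]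
    constructor
    · rintro ⟨y, hy⟩
      exact exists_lMap_eq (R.isGradedFree _).isGraded (R.isGradedFree _).isGraded (R.d_mem _) hy
    · rintro ⟨y, rfl⟩
      exact ⟨_, (lVal_lMap _ _ y).symm⟩

end LResolution

/-! ### Compatibility of `𝔩_σ` with duality -/

section Dual

variable {K : Type u} [Field K] {ι : Type} [Fintype ι] [DecidableEq ι] {σ : Finset ι}
  {P P' : ModuleCat.{u} (MvPolynomial ι K)}
  {J : Type} [Finite J] [DecidableEq J] {𝒬 : (ι → ℤ) → AddSubgroup P}
  {b : Module.Basis J (MvPolynomial ι K) P} {d : J → ι → ℤ}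
  {J' : Type} [Finite J'] [DecidableEq J'] {𝒬' : (ι → ℤ) → AddSubgroup P'}
  {b' : Module.Basis J' (MvPolynomial ι K) P'} {d' : J' → ι → ℤ}

/-- Off `σ` the exponents are `1 - δ` and `δ`, with sum 1. The result is the exponent `σᶜ`,
independent of `δ`, which makes the duality isomorphism natural. -/
theorem lExp_add_lExp {δ : ι → ℤ} (h0 : 0 ≤ δ) (h1 : δ ≤ 1) :
    lExp σ δ + lExp σ (1 - δ) = lExp σ 0 := by
  ext i
  have h0 := h0 i
  have h1 := h1 i
  simp only [Pi.zero_apply, Pi.one_apply] at h0 h1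
  by_cases hi : i ∈ σ
  · simp [lExp, hi]
  · simp only [lExp, Finsupp.coe_add, Pi.add_apply, Finsupp.equivFunOnFinite_symm_apply_apply, hi,
      if_false, Pi.sub_apply, Pi.one_apply, Pi.zero_apply]
    lia

theorem one_sub_deg_nonneg (h1 : ∀ j, d j ≤ 1) (j : J) : 0 ≤ 1 - d j := sub_nonneg.2 (h1 j)

theorem one_sub_deg_le_one (h0 : ∀ j, 0 ≤ d j) (j : J) : 1 - d j ≤ 1 := sub_le_self _ (h0 j)

/-- The isomorphism `𝔩_σ(Hom_S(P, ω)) ≅ Hom_{K[σ]}(𝔩_σ(P), ω)` for a graded free module `P`. -/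
def lDualEquiv (σ : Finset ι) (h : IsGradedFree 𝒬 b d) (h0 : ∀ j, 0 ≤ d j) (h1 : ∀ j, d j ≤ 1) :
    lModule (dualGrading 𝒬) σ ≃ₗ[MvPolynomial σ K] dualModule (lModule 𝒬 σ) :=
  (lBasis σ h.dual (one_sub_deg_nonneg h1) (one_sub_deg_le_one h0)).repr ≪≫ₗ
    (lBasis σ h h0 h1).dualBasis.repr.symm

theorem lDualEquiv_repr (h : IsGradedFree 𝒬 b d) (h0 : ∀ j, 0 ≤ d j) (h1 : ∀ j, d j ≤ 1)
    (f : lModule (dualGrading 𝒬) σ) (j : J) :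
    (lBasis σ h h0 h1).dualBasis.repr (lDualEquiv σ h h0 h1 f) j =
      (lBasis σ h.dual (one_sub_deg_nonneg h1) (one_sub_deg_le_one h0)).repr f j :=
  DFunLike.congr_fun (LinearEquiv.apply_symm_apply _ _) j

/-- Both sides are free on matched bases whose degrees agree: restricting `1 - d j` to `σ` is the
same as subtracting the restriction of `d j` from `1`. -/
theorem mem_lGrading_dual_iff (h : IsGradedFree 𝒬 b d) (h0 : ∀ j, 0 ≤ d j) (h1 : ∀ j, d j ≤ 1)
    (α : σ → ℤ) (f : lModule (dualGrading 𝒬) σ) :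
    f ∈ lGrading (dualGrading 𝒬) σ α ↔
      lDualEquiv σ h h0 h1 f ∈ dualGrading (lGrading 𝒬 σ) α := by
  rw [(isGradedFree_lGrading h.dual (one_sub_deg_nonneg h1) (one_sub_deg_le_one h0)) α f,
    (isGradedFree_lGrading h h0 h1).dual α]
  refine forall_congr' fun j => ?_
  rw [lDualEquiv_repr]
  rfl

/-- Checked on the basis, where it is `lExp_add_lExp`, and extended linearly. As multiplication by
`x^(σᶜ)` is injective, the formula determines the isomorphism without reference to bases. -/
theorem inclusion_lDualEquiv (h : IsGradedFree 𝒬 b d) (h0 : ∀ j, 0 ≤ d j) (h1 : ∀ j, d j ≤ 1)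
    (f : lModule (dualGrading 𝒬) σ) (p : lModule 𝒬 σ) :
    inclusion K σ ((lDualEquiv σ h h0 h1 f : Module.Dual (MvPolynomial σ K) (lModule 𝒬 σ)) p) *
      MvPolynomial.monomial (lExp σ 0) 1 =
        (lVal (dualGrading 𝒬) σ f : Module.Dual (MvPolynomial ι K) P) (lVal 𝒬 σ p) := by
  have : Fintype J := Fintype.ofFinite J
  have key : ∀ j, inclusion K σ
      ((lDualEquiv σ h h0 h1 f : Module.Dual (MvPolynomial σ K) (lModule 𝒬 σ))
        (lBasis σ h h0 h1 j)) * MvPolynomial.monomial (lExp σ 0) 1 =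
      (lVal (dualGrading 𝒬) σ f : Module.Dual (MvPolynomial ι K) P)
        (lVal 𝒬 σ (lBasis σ h h0 h1 j)) := fun j => by
    rw [lVal_lBasis, map_smul, ← b.dualBasis_repr, ← Module.Basis.dualBasis_repr,
      lDualEquiv_repr h h0 h1, smul_eq_mul]
    have := repr_lVal (σ := σ) h.dual (one_sub_deg_nonneg h1) (one_sub_deg_le_one h0) f j
    rw [this, mul_left_comm, MvPolynomial.monomial_mul, one_mul, lExp_add_lExp (h0 j) (h1 j)]
  have hsmul : ∀ (r : MvPolynomial σ K) (x : lModule 𝒬 σ),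
      (lVal (dualGrading 𝒬) σ f : Module.Dual (MvPolynomial ι K) P) (lVal 𝒬 σ (r • x)) =
        inclusion K σ r *
          (lVal (dualGrading 𝒬) σ f : Module.Dual (MvPolynomial ι K) P) (lVal 𝒬 σ x) :=
    fun r x => map_smul (lVal (dualGrading 𝒬) σ f : Module.Dual (MvPolynomial ι K) P) _ _
  rw [← (lBasis σ h h0 h1).sum_repr p]
  simp only [map_sum, Finset.sum_mul, map_smul, smul_eq_mul, map_mul, mul_assoc, key]
  exact Finset.sum_congr rfl fun j _ => (hsmul _ _).symm

/-- The transpose of a map of modules. -/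
def transpose (u : P' ⟶ P) : dualModule P ⟶ dualModule P' :=
  ModuleCat.ofHom u.hom.dualMap

theorem isHomogeneousMap_transpose {u : P' ⟶ P} (hu : IsHomogeneousMap 𝒬' 𝒬 0 u) :
    IsHomogeneousMap (dualGrading 𝒬) (dualGrading 𝒬') 0 (transpose u) :=
  isHomogeneousMap_zero_of fun α f hf β m hm => hf β _ (hu.mem hm)

/-- After inclusion into `S` and multiplication by `x^(σᶜ)`, both sides evaluate at `p` to `f`
applied to `u(p)`. -/
theorem lDualEquiv_transpose (h : IsGradedFree 𝒬 b d) (h0 : ∀ j, 0 ≤ d j) (h1 : ∀ j, d j ≤ 1)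
    (h' : IsGradedFree 𝒬' b' d') (h0' : ∀ j, 0 ≤ d' j) (h1' : ∀ j, d' j ≤ 1)
    {u : P' ⟶ P} (hu : IsHomogeneousMap 𝒬' 𝒬 0 u) (f : lModule (dualGrading 𝒬) σ) :
    lDualEquiv σ h' h0' h1' ((lMap σ h.dual.isGraded (isHomogeneousMap_transpose hu)).hom f) =
      (transpose (lMap σ h'.isGraded hu)).hom (lDualEquiv σ h h0 h1 f) := by
  refine LinearMap.ext fun p => inclusion_mul_monomial_injective (e := lExp σ 0) ?_
  refine (inclusion_lDualEquiv h' h0' h1' _ p).trans ?_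
  exact (inclusion_lDualEquiv h h0 h1 f ((lMap σ h'.isGraded hu).hom p)).symm

end Dual

/-! ### Graded cohomology and `𝔩_σ` -/

section Cohomology

variable {K : Type u} [Field K] {ι : Type} [Fintype ι] [DecidableEq ι] {σ : Finset ι}
  {A B C E : ModuleCat.{u} (MvPolynomial ι K)}
  {𝒜 : (ι → ℤ) → AddSubgroup A} {ℬ : (ι → ℤ) → AddSubgroup B} {𝒞 : (ι → ℤ) → AddSubgroup C}
  {ℰ : (ι → ℤ) → AddSubgroup E} {a : A ⟶ B} {δ : B ⟶ C}

/-- The map `q` exhibits `E` as the graded cohomology module of the sequence `A → B → C`. -/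
structure IsGradedCohomology (ℬ : (ι → ℤ) → AddSubgroup B) (ℰ : (ι → ℤ) → AddSubgroup E)
    (a : A ⟶ B) (δ : B ⟶ C) (q : LinearMap.ker δ.hom →ₗ[MvPolynomial ι K] E) : Prop where
  surjective : Function.Surjective q
  δ_a : ∀ x, δ.hom (a.hom x) = 0
  eq_zero_iff : ∀ z, q z = 0 ↔ ∃ x, a.hom x = z
  mem_iff : ∀ α e, e ∈ ℰ α ↔ ∃ z : LinearMap.ker δ.hom, (z : B) ∈ ℬ α ∧ q z = e

variable {q : LinearMap.ker δ.hom →ₗ[MvPolynomial ι K] E}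

theorem IsGradedCohomology.isSquarefree (h : IsGradedCohomology ℬ ℰ a δ q)
    (hA : IsSquarefree 𝒜) (hB : IsSquarefree ℬ) (hC : IsSquarefree 𝒞)
    (ha : IsHomogeneousMap 𝒜 ℬ 0 a) (hδ : IsHomogeneousMap ℬ 𝒞 0 δ) : IsSquarefree ℰ := by
  let a' : A ⟶ kerModule δ := ModuleCat.ofHom (LinearMap.codRestrict _ a.hom h.δ_a)
  have ha' : IsHomogeneousMap 𝒜 (kerGrading ℬ δ) 0 a' :=
    isHomogeneousMap_zero_of fun α m hm => ha.mem hm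
  refine isSquarefree_of_surjective hA (isSquarefree_kerGrading hB hC hδ) ha'
    (ModuleCat.ofHom q) h.surjective (fun z => (h.eq_zero_iff z).trans ?_) fun α e => ?_
  · exact exists_congr fun x => ⟨fun hx => Subtype.ext hx, fun hx => congrArg Subtype.val hx⟩
  · exact h.mem_iff α e

/-- Passing to classes preserves degrees, so a class acquires no component in a degree where its
cocycle has none. -/
theorem IsGradedCohomology.inL (h : IsGradedCohomology ℬ ℰ a δ q) (hB : IsGraded ℬ)
    (hC : IsGraded 𝒞) (hE : IsGraded ℰ) (hδ : IsHomogeneousMap ℬ 𝒞 0 δ)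
    {z : LinearMap.ker δ.hom} (hz : InL ℬ σ (z : B)) : InL ℰ σ (q z) := by
  have hZ := isGraded_kerGrading hB hC hδ
  have hq : IsHomogeneousMap (M := kerModule δ) (kerGrading ℬ δ) ℰ 0 (ModuleCat.ofHom q) :=
    isHomogeneousMap_zero_of fun α m hm => (h.mem_iff α _).2 ⟨m, hm, rfl⟩
  have hι : IsHomogeneousMap (M := kerModule δ) (kerGrading ℬ δ) ℬ 0
      (ModuleCat.ofHom (LinearMap.ker δ.hom).subtype) :=
    isHomogeneousMap_zero_of fun α m hm => hm
  refine inL_of_component hE fun β => ?_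
  by_cases hβ : ∃ α : σ → ℤ, 0 ≤ α ∧ lDeg σ α = β
  · obtain ⟨α, hα, rfl⟩ := hβ
    exact inL_of_mem hα (component_mem _ _ _)
  · have h1 := hz.component_eq_zero hB β fun α hα h => hβ ⟨α, hα, h⟩
    have h2 : component hZ.isInternal β z = 0 :=
      Subtype.ext ((hι.component hZ hB β z).symm.trans h1)
    have h3 : component hE.isInternal β (q z) = q (component hZ.isInternal β z) :=
      hq.component hZ hE β z
    rw [h3, h2, map_zero]
    exact InL.zero

/-- The comparison of `𝔩_σ` of the cohomology of a sequence with the cohomology of `𝔩_σ` of the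
sequence. -/
theorem IsGradedCohomology.gradedIso (h : IsGradedCohomology ℬ ℰ a δ q) (hA : IsGraded 𝒜)
    (hB : IsGraded ℬ) (hC : IsGraded 𝒞) (hE : IsGraded ℰ) (ha : IsHomogeneousMap 𝒜 ℬ 0 a)
    (hδ : IsHomogeneousMap ℬ 𝒞 0 δ)
    {A' B' C' E' : ModuleCat.{u} (MvPolynomial σ K)} {ℬ' : (σ → ℤ) → AddSubgroup B'}
    {ℰ' : (σ → ℤ) → AddSubgroup E'} {a' : A' ⟶ B'} {δ' : B' ⟶ C'}
    {q' : LinearMap.ker δ'.hom →ₗ[MvPolynomial σ K] E'} (h' : IsGradedCohomology ℬ' ℰ' a' δ' q')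
    (ΦA : lModule 𝒜 σ ≃ₗ[MvPolynomial σ K] A') (ΦB : lModule ℬ σ ≃ₗ[MvPolynomial σ K] B')
    (ΦC : lModule 𝒞 σ ≃ₗ[MvPolynomial σ K] C')
    (hΦa : ∀ x, ΦB ((lMap σ hA ha).hom x) = a'.hom (ΦA x))
    (hΦδ : ∀ x, ΦC ((lMap σ hB hδ).hom x) = δ'.hom (ΦB x))
    (hΦ : ∀ α x, x ∈ lGrading ℬ σ α ↔ ΦB x ∈ ℬ' α) : GradedIso (lGrading ℰ σ) ℰ' := by
  -- Both cohomology modules are exhibited as quotients of the cocycles `W` of `𝔩_σ(B)`; it then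
  -- suffices that the two kernels agree.
  let W : Submodule (MvPolynomial σ K) (lModule ℬ σ) := LinearMap.ker (lMap σ hB hδ).hom
  have hW : ∀ x, x ∈ W ↔ lVal ℬ σ x ∈ LinearMap.ker δ.hom := fun x => by
    rw [LinearMap.mem_ker, LinearMap.mem_ker, ← lVal_lMap hB hδ, ← lVal_injective.eq_iff, map_zero]
  have hW' : ∀ x, x ∈ W ↔ ΦB x ∈ LinearMap.ker δ'.hom := fun x => by
    rw [LinearMap.mem_ker, LinearMap.mem_ker, ← hΦδ, ΦC.map_eq_zero_iff]
  let z : W → LinearMap.ker δ.hom := fun w => ⟨lVal ℬ σ w.1, (hW w.1).1 w.2⟩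
  have hz : ∀ w, InL ℰ σ (q (z w)) := fun w => h.inL hB hC hE hδ (inL_lVal w.1)
  choose qW hqW using fun w => (hz w).exists_lVal_eq
  let Q : W →ₗ[MvPolynomial σ K] lModule ℰ σ :=
    { toFun := qW
      map_add' := fun w w' => lVal_injective (by
        rw [map_add, hqW, hqW, hqW, ← map_add]
        rfl)
      map_smul' := fun r w => lVal_injective (by
        rw [RingHom.id_apply, lVal_smul, hqW, hqW, ← map_smul]
        rfl) }
  let Q' : W →ₗ[MvPolynomial σ K] E' :=
    q' ∘ₗ ΦB.toLinearMap.restrict (p := W) (q := LinearMap.ker δ'.hom) fun x hx => (hW' x).1 hx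
  have hQ : Function.Surjective Q := by
    intro e
    refine lModule_induction hE (C := fun e => ∃ w, Q w = e) e (fun α hα e he => ?_)
      ⟨0, map_zero _⟩ ?_
    · obtain ⟨y, hy, hye⟩ := (h.mem_iff _ _).1 (lVal_mem he)
      obtain ⟨x, hx⟩ := (inL_of_mem hα hy).exists_lVal_eq
      refine ⟨⟨x, (hW x).2 (hx ▸ y.2)⟩, lVal_injective ((hqW _).trans ?_)⟩
      rw [← hye]
      exact congrArg q (Subtype.ext hx)
    · rintro _ _ ⟨w, rfl⟩ ⟨w', rfl⟩
      exact ⟨w + w', map_add _ _ _⟩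
  have hQ' : Function.Surjective Q' := by
    intro e
    obtain ⟨y, rfl⟩ := h'.surjective e
    refine ⟨⟨ΦB.symm y.1, (hW' _).2 ?_⟩, congrArg q' (Subtype.ext (ΦB.apply_symm_apply y.1))⟩
    rw [ΦB.apply_symm_apply]
    exact y.2
  have hker : LinearMap.ker Q = LinearMap.ker Q' := by
    ext w
    rw [LinearMap.mem_ker, LinearMap.mem_ker]
    have e1 : Q w = 0 ↔ q (z w) = 0 := by
      rw [← hqW, ← lVal_injective.eq_iff, map_zero]
      rfl
    rw [e1, h.eq_zero_iff]
    refine Iff.trans ?_ (h'.eq_zero_iff _).symm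
    constructor
    · rintro ⟨x, hx⟩
      -- A cocycle in `𝔩_σ(B)` bounding in `A` already bounds in `𝔩_σ(A)`, by exactness of `𝔩_σ`.
      obtain ⟨y, hy⟩ := exists_lMap_eq hA hB ha (y := w.1) hx
      exact ⟨ΦA y, by rw [← hΦa, hy]; rfl⟩
    · rintro ⟨x, hx⟩
      refine ⟨lVal 𝒜 σ (ΦA.symm x), ?_⟩
      rw [← lVal_lMap hA ha]
      refine congrArg (lVal ℬ σ) (ΦB.injective ?_)
      rw [hΦa, ΦA.apply_symm_apply, hx]
      rfl
  let e := (Q.quotKerEquivOfSurjective hQ).symm ≪≫ₗ Submodule.quotEquivOfEq _ _ hker ≪≫ₗ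
    Q'.quotKerEquivOfSurjective hQ'
  have he : ∀ w, e (Q w) = Q' w := fun w => by
    have : (Q.quotKerEquivOfSurjective hQ).symm (Q w) = Submodule.Quotient.mk w := by
      rw [LinearEquiv.symm_apply_eq]
      rfl
    rw [LinearEquiv.trans_apply, LinearEquiv.trans_apply, this]
    rfl
  refine ⟨e, fun α x => ⟨fun hx => ?_, fun hx => ?_⟩⟩
  · by_cases hα : 0 ≤ α
    · obtain ⟨y, hy, hye⟩ := (h.mem_iff _ _).1 (lVal_mem hx)
      obtain ⟨v, hv⟩ := (inL_of_mem hα hy).exists_lVal_eq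
      have hvW : v ∈ W := (hW v).2 (hv ▸ y.2)
      have : x = Q ⟨v, hvW⟩ := lVal_injective (by
        rw [← hye]
        refine Eq.trans ?_ (hqW ⟨v, hvW⟩).symm
        exact congrArg q (Subtype.ext hv.symm))
      rw [this, he]
      refine (h'.mem_iff _ _).2 ⟨_, ?_, rfl⟩
      refine (hΦ α v).1 ((mem_lGrading_iff hα).2 ?_)
      rw [hv]
      exact hy
    · rw [eq_zero_of_mem_lGrading hα hx, map_zero]
      exact zero_mem _
  · obtain ⟨y, hy, hye⟩ := (h'.mem_iff _ _).1 hx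
    have hyW : ΦB.symm y.1 ∈ W := (hW' _).2 (by
      rw [ΦB.apply_symm_apply]
      exact y.2)
    have hyα : ΦB.symm y.1 ∈ lGrading ℬ σ α := (hΦ _ _).2 (by
      rw [ΦB.apply_symm_apply]
      exact hy)
    have : x = Q ⟨_, hyW⟩ := e.injective (by
      rw [he, ← hye]
      exact congrArg q' (Subtype.ext (ΦB.apply_symm_apply y.1).symm))
    rw [this]
    by_cases hα : 0 ≤ α
    · rw [mem_lGrading_iff hα]
      exact (h.mem_iff _ _).2 ⟨_, lVal_mem hyα, (hqW _).symm⟩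
    · have h0 : (⟨_, hyW⟩ : W) = 0 := Subtype.ext (eq_zero_of_mem_lGrading hα hyα)
      rw [h0, map_zero]
      exact zero_mem _

end Cohomology

/-! ### Application to the dual of a free resolution -/

namespace FreeResolution

variable {K : Type u} [Field K] {ι : Type} [Fintype ι] [DecidableEq ι]
  {M : ModuleCat.{u} (MvPolynomial ι K)} {ℳ : (ι → ℤ) → AddSubgroup M} (R : FreeResolution ℳ)

/-- The class in `Ext^i_S(M, S)` of a cocycle in the dual complex. -/
def dualClass (i : ℕ) : LinearMap.ker (transpose (R.d i)).hom →ₗ[MvPolynomial ι K]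
    extModule M (polyModule K ι) i :=
  R.extClass i (polyModule K ι)

theorem dualClass_mem_iff (hM : IsGraded ℳ) (i : ℕ) (α : ι → ℤ)
    (e : extModule M (polyModule K ι) i) :
    e ∈ extGrading ℳ (omegaGrading K ι) i α ↔
      ∃ z : LinearMap.ker (transpose (R.d i)).hom,
        (z : dualModule (R.X i)) ∈ dualGrading (R.gr i) α ∧ R.dualClass i z = e :=
  R.mem_extGrading_iff hM

theorem dualClass_surjective (i : ℕ) : Function.Surjective (R.dualClass i) :=
  R.extClass_surjective i

theorem dualClass_zero_eq_zero_iff (z : LinearMap.ker (transpose (R.d 0)).hom) :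
    R.dualClass 0 z = 0 ↔
      ∃ x, (0 : dualModule (R.X 0) ⟶ dualModule (R.X 0)).hom x = (z : dualModule (R.X 0)) := by
  have h := R.extClass_zero_eq_zero_iff (N := polyModule K ι) z
  refine h.trans ?_
  exact ⟨fun h => ⟨0, h.symm⟩, fun ⟨_, hx⟩ => hx.symm⟩

theorem dualClass_succ_eq_zero_iff (i : ℕ) (z : LinearMap.ker (transpose (R.d (i + 1))).hom) :
    R.dualClass (i + 1) z = 0 ↔
      ∃ x, (transpose (R.d i)).hom x = (z : dualModule (R.X (i + 1))) :=
  R.extClass_succ_eq_zero_iff (N := polyModule K ι) i z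

theorem transpose_comp_transpose (i : ℕ) (f : dualModule (R.X i)) :
    (transpose (R.d (i + 1))).hom ((transpose (R.d i)).hom f) = 0 :=
  LinearMap.ext fun x =>
    (congrArg (f : Module.Dual (MvPolynomial ι K) (R.X i))
      ((R.exact_succ i _).2 ⟨x, rfl⟩)).trans (map_zero _)

/-- Degree 0 has no incoming differential. A zero endomorphism takes its place, with a squarefree
source so that the general results apply. -/
theorem isGradedCohomology_zero (hM : IsGraded ℳ) :
    IsGradedCohomology (dualGrading (R.gr 0)) (extGrading ℳ (omegaGrading K ι) 0)
      (0 : dualModule (R.X 0) ⟶ dualModule (R.X 0)) (transpose (R.d 0)) (R.dualClass 0) where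
  surjective := R.dualClass_surjective 0
  δ_a _ := map_zero _
  eq_zero_iff := R.dualClass_zero_eq_zero_iff
  mem_iff := R.dualClass_mem_iff hM 0

theorem isGradedCohomology_succ (hM : IsGraded ℳ) (i : ℕ) :
    IsGradedCohomology (dualGrading (R.gr (i + 1))) (extGrading ℳ (omegaGrading K ι) (i + 1))
      (transpose (R.d i)) (transpose (R.d (i + 1))) (R.dualClass (i + 1)) where
  surjective := R.dualClass_surjective (i + 1)
  δ_a := R.transpose_comp_transpose i
  eq_zero_iff := R.dualClass_succ_eq_zero_iff i
  mem_iff := R.dualClass_mem_iff hM (i + 1)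

theorem isSquarefree_dual (k : ℕ) : IsSquarefree (dualGrading (R.gr k)) := by
  classical
  have := R.finite k
  exact (R.isGradedFree k).dual.isSquarefree (one_sub_deg_nonneg (R.deg_le_one k))
    (one_sub_deg_le_one (R.deg_nonneg k))

theorem isSquarefree_extGrading (R : FreeResolution ℳ) (hM : IsGraded ℳ) (i : ℕ) :
    IsSquarefree (extGrading ℳ (omegaGrading K ι) i) := by
  cases i with
  | zero =>
    exact (R.isGradedCohomology_zero hM).isSquarefree (R.isSquarefree_dual 0)
      (R.isSquarefree_dual 0) (R.isSquarefree_dual 1)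
      (fun _ _ _ => zero_mem _) (isHomogeneousMap_transpose (R.d_mem 0))
  | succ i =>
    exact (R.isGradedCohomology_succ hM i).isSquarefree (R.isSquarefree_dual i)
      (R.isSquarefree_dual (i + 1)) (R.isSquarefree_dual (i + 2))
      (isHomogeneousMap_transpose (R.d_mem i)) (isHomogeneousMap_transpose (R.d_mem (i + 1)))

open scoped Classical in
/-- The isomorphism `𝔩_σ(Hom_S(P_k, ω)) ≅ Hom_{K[σ]}(𝔩_σ(P_k), ω)`. -/
def dualEquiv (σ : Finset ι) (k : ℕ) :
    lModule (dualGrading (R.gr k)) σ ≃ₗ[MvPolynomial σ K] dualModule (lModule (R.gr k) σ) :=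
  have := R.finite k
  lDualEquiv σ (R.isGradedFree k) (R.deg_nonneg k) (R.deg_le_one k)

theorem mem_lGrading_iff_dualEquiv (σ : Finset ι) (k : ℕ) (α : σ → ℤ)
    (f : lModule (dualGrading (R.gr k)) σ) :
    f ∈ lGrading (dualGrading (R.gr k)) σ α ↔
      R.dualEquiv σ k f ∈ dualGrading (lGrading (R.gr k) σ) α := by
  classical
  have := R.finite k
  exact mem_lGrading_dual_iff _ _ _ α f

theorem dualEquiv_transpose (σ : Finset ι) (k : ℕ) (f : lModule (dualGrading (R.gr k)) σ) :
    R.dualEquiv σ (k + 1) ((lMap σ (R.isSquarefree_dual k).isGraded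
      (isHomogeneousMap_transpose (R.d_mem k))).hom f) =
      (transpose (lMap σ (R.isGradedFree (k + 1)).isGraded (R.d_mem k))).hom
        (R.dualEquiv σ k f) := by
  classical
  have := R.finite k
  have := R.finite (k + 1)
  exact lDualEquiv_transpose _ _ _ _ _ _ _ f

theorem gradedIso_extGrading (R : FreeResolution ℳ) (hM : IsGraded ℳ) (σ : Finset ι) (i : ℕ) :
    GradedIso (lGrading (extGrading ℳ (omegaGrading K ι) i) σ)
      (extGrading (lGrading ℳ σ) (omegaGrading K σ) i) := by
  have hE := (R.isSquarefree_extGrading hM i).isGraded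
  cases i with
  | zero =>
    exact (R.isGradedCohomology_zero hM).gradedIso (R.isSquarefree_dual 0).isGraded
      (R.isSquarefree_dual 0).isGraded (R.isSquarefree_dual 1).isGraded hE
      (fun _ _ _ => zero_mem _) (isHomogeneousMap_transpose (R.d_mem 0))
      ((R.restrict hM σ).isGradedCohomology_zero (isGraded_lGrading hM))
      (R.dualEquiv σ 0) (R.dualEquiv σ 0) (R.dualEquiv σ 1)
      (fun x => map_zero (R.dualEquiv σ 0)) (R.dualEquiv_transpose σ 0)
      (R.mem_lGrading_iff_dualEquiv σ 0)
  | succ i =>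
    exact (R.isGradedCohomology_succ hM i).gradedIso (R.isSquarefree_dual i).isGraded
      (R.isSquarefree_dual (i + 1)).isGraded (R.isSquarefree_dual (i + 2)).isGraded hE
      (isHomogeneousMap_transpose (R.d_mem i)) (isHomogeneousMap_transpose (R.d_mem (i + 1)))
      ((R.restrict hM σ).isGradedCohomology_succ (isGraded_lGrading hM) i)
      (R.dualEquiv σ i) (R.dualEquiv σ (i + 1)) (R.dualEquiv σ (i + 2))
      (R.dualEquiv_transpose σ i) (R.dualEquiv_transpose σ (i + 1))
      (R.mem_lGrading_iff_dualEquiv σ (i + 1))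

end FreeResolution

end Multigraded

end

theorem mainTheorem6 {K : Type u} [Field K] (n : ℕ)
    (M : ModuleCat.{u} (MvPolynomial (Fin n) K)) (ℳ : (Fin n → ℤ) → AddSubgroup M)
    (hM : Multigraded.IsSquarefree ℳ) (σ : Finset (Fin n)) (i : ℕ) :
    Multigraded.IsSquarefree
        (Multigraded.extGrading ℳ (Multigraded.omegaGrading K (Fin n)) i) ∧
      Multigraded.GradedIso
        (Multigraded.lGrading
          (Multigraded.extGrading ℳ (Multigraded.omegaGrading K (Fin n)) i) σ)
        (Multigraded.extGrading
          (Multigraded.lGrading ℳ σ) (Multigraded.omegaGrading K σ) i) :=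
  let R := Multigraded.SquarefreeModule.freeResolution ⟨M, ℳ, hM⟩
  ⟨R.isSquarefree_extGrading hM.isGraded i, R.gradedIso_extGrading hM.isGraded σ i⟩
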